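/- **Theorem (convergence of counter-based frequency-aware SGD, CF-SGD).** Let $U$ (users) and $V$ (items) be finite sets, $X = U \sqcup V$ the set of tokens, $D$ a probability distribution on $U\times V$ with marginals $p_i=\sum_{j\in V} D(i,j)$ $(i\in U)$ and $p_j=\sum_{i\in U} D(i,j)$ $(j\in V)$, all positive, let $y_{ij}\in\{-1,+1\}$, and let $$f(\Theta)=\sum_{i\in U,\,j\in V} D(i,j)\,\ell(\theta_i,\theta_j;y_{ij}),\qquad \Theta=(\theta_k)_{k\in X}\in(\mathbb R^d)^X,\qquad f^*=\inf f>-\infty .$$ Write $\nabla f_k(\Theta)$ for the $k$-th row of $\nabla f(\Theta)$. Assume: 1. (Smoothness) $\ell(u,v;y)$ is symmetric in $u,v$ and twice differentiable in $(u,v)$, and for some $L>0$ one has $\|\nabla^2_{uu}\ell\|_2\le L$ and $\|\nabla^2_{uv}\ell\|_2\le L$ everywhere. 2. (Bounded gradient) $\|\nabla f(\Theta)\|\le G$ for all $\Theta$, with $G>0$. CF-SGD with total iteration number $T$ starts from a given $\Theta^0$ with counters $c_k^0=0$. At step $t=0,1,\dots$ it draws $(i_t,j_t)\sim D$ independently of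 the past, computes $g^t_{i_t}=\nabla_{\theta_{i_t}}\ell(\theta^t_{i_t},\theta^t_{j_t};y_{i_tj_t})$ and $g^t_{j_t}=\nabla_{\theta_{j_t}}\ell(\theta^t_{i_t},\theta^t_{j_t};y_{i_tj_t})$, sets $\theta_k^{t+1}=\theta_k^t-\hat\eta_k^t g_k^t$ and $c_k^{t+1}=c_k^t+1$ for $k\in\{i_t,j_t\}$, and leaves all other rows and counters unchanged. The steps are $$\hat\eta_k^t=\min\Big\{\frac1{4L},\ \frac{\alpha}{\sqrt{T\,\hat p_k^t}}\Big\},\qquad \hat p_k^t=\frac{c_k^t}{t},$$ with $\hat\eta_k^t=1/(4L)$ when $c_k^t=0$, where, for given $(\sigma_l)_{l\in X}$ with $\sum_l p_l\sigma_l^2>0$, $$M_f=f(\Theta^0)-f^*+\sum_{l\in X}\frac{p_l\sigma_l^2}{L},\qquad \alpha=\sqrt{\frac{M_f}{L\sum_{l\in X}p_l\sigma_l^2}} .$$ The output is $\Theta^\tau$, where $\tau$ is independent of the samples and uniform on the integers $t$ with $T/2\le t\le T$. 3. (Bounded conditional variance) For every $t\le T$, almost surely, the iterate $\Theta^t$ satisfies,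 with $\delta^t_k=\frac1{p_k}\nabla f_k(\Theta^t)-g^t_k$: conditionally on the past, $\mathbb E[\|\delta^t_{i_t}\|^2\mid i_t=i]\le\sigma_i^2$ for all $i\in U$ and $\mathbb E[\|\delta^t_{j_t}\|^2\mid j_t=j]\le\sigma_j^2$ for all $j\in V$. Then there is an absolute constant $C>0$ (the same for all problems of the above kind) such that for every token $k\in X$, $$\mathbb E\|\nabla f_k(\Theta^\tau)\|^2\ \le\ C\left(\frac{L M_f}{T}+\frac{\sqrt{p_k}\,\sqrt{\sum_{l\in X}p_l\sigma_l^2\,L\,(f(\Theta^0)-f^*)}}{\sqrt T}+\frac{\sqrt{p_k}\,\sum_{l\in X}p_l\sigma_l^2}{\sqrt T}\right)$$ whenever $$T\ \ge\ \max\left\{\min_{l\in X}\frac1{p_l},\ \frac{2\log G-\log\!\big(M_f\,(\tfrac1{2L}+\alpha/\sqrt{p_k})\big)}{p_k}\right\}.$$ -/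

import Mathlib

open MeasureTheory ProbabilityTheory

noncomputable section

namespace FreqSGD

/-- Embedding vectors: `ℝᵈ` with the Euclidean norm. -/
abbrev Emb (d : ℕ) : Type := EuclideanSpace ℝ (Fin d)

/-- Parameters `Θ ∈ ℝ^{N × d}`: one row for each token, the tokens being the disjoint union of the
users `U` and the items `V`. The norm is the Frobenius norm. -/
abbrev Params (U V : Type*) [Fintype U] [Fintype V] (d : ℕ) : Type _ :=
  PiLp 2 (fun _ : U ⊕ V => Emb d)

/-- The data of an embedding learning problem: the interaction distribution `D` on user-item
pairs, the labels `y_{ij} ∈ {-1, +1}` (the units of `ℤ`), and the prediction loss `ℓ(u, v; y)`. -/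
structure Problem (U V : Type*) (d : ℕ) where
  D : PMF (U × V)
  label : U → V → ℤˣ
  loss : Emb d → Emb d → ℤˣ → ℝ

variable {U V : Type*} [Fintype U] [Fintype V] {d : ℕ}

namespace Problem

/-- The probability `D(i, j)` as a real number. -/
def prob (P : Problem U V d) (i : U) (j : V) : ℝ := (P.D (i, j)).toReal

/-- The marginal token frequencies: `p_i = ∑_j D(i, j)` for users, `p_j = ∑_i D(i, j)` for items. -/
def freq (P : Problem U V d) : U ⊕ V → ℝ
  | Sum.inl i => ∑ j, P.prob i j
  | Sum.inr j => ∑ i, P.prob i j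

/-- The objective `f(Θ) = ∑_{i, j} D(i, j) ℓ(θ_i, θ_j; y_{ij})`. -/
def obj (P : Problem U V d) (Θ : Params U V d) : ℝ :=
  ∑ i, ∑ j, P.prob i j * P.loss (Θ (Sum.inl i)) (Θ (Sum.inr j)) (P.label i j)

/-- The optimal value `f* = inf f`. -/
def optVal (P : Problem U V d) : ℝ := ⨅ Θ, P.obj Θ

/-- The partial gradient `∇_u ℓ(u, v; y)`. -/
def gradFst (P : Problem U V d) (u v : Emb d) (y : ℤˣ) : Emb d :=
  gradient (fun u' => P.loss u' v y) u

/-- The partial gradient `∇_v ℓ(u, v; y)`. -/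
def gradSnd (P : Problem U V d) (u v : Emb d) (y : ℤˣ) : Emb d :=
  gradient (fun v' => P.loss u v' y) v

open Classical in
/-- The sparse stochastic gradient at `Θ` for the sampled pair `z = (i, j)`: row `i` is
`∇_{θ_i} ℓ(θ_i, θ_j; y_{ij})`, row `j` is `∇_{θ_j} ℓ(θ_i, θ_j; y_{ij})`, all other rows vanish. -/
def stochGrad (P : Problem U V d) (Θ : Params U V d) (z : U × V) : U ⊕ V → Emb d
  | Sum.inl i =>
      if i = z.1 then
        P.gradFst (Θ (Sum.inl z.1)) (Θ (Sum.inr z.2)) (P.label z.1 z.2)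
      else 0
  | Sum.inr j =>
      if j = z.2 then
        P.gradSnd (Θ (Sum.inl z.1)) (Θ (Sum.inr z.2)) (P.label z.1 z.2)
      else 0

/-- Bounded conditional variance at the point `Θ`. With `δ_k = (1 / p_k) ∇f_k(Θ) - g_k`, it says
`𝔼[‖δ_i‖² | i_t = i] ≤ σ_i²` for every user `i` and `𝔼[‖δ_j‖² | j_t = j] ≤ σ_j²` for every item
`j`; given `i_t = i`, the item is `j` with probability `D(i, j) / p_i`, and symmetrically. -/
def CondVarianceLE (P : Problem U V d) (σ : U ⊕ V → ℝ) (Θ : Params U V d) : Prop :=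
  (∀ i : U,
    ∑ j, P.prob i j / P.freq (Sum.inl i) *
      ‖(1 / P.freq (Sum.inl i)) • gradient P.obj Θ (Sum.inl i)
        - P.stochGrad Θ (i, j) (Sum.inl i)‖ ^ 2 ≤ σ (Sum.inl i) ^ 2) ∧
  (∀ j : V,
    ∑ i, P.prob i j / P.freq (Sum.inr j) *
      ‖(1 / P.freq (Sum.inr j)) • gradient P.obj Θ (Sum.inr j)
        - P.stochGrad Θ (i, j) (Sum.inr j)‖ ^ 2 ≤ σ (Sum.inr j) ^ 2)

/-- Smoothness of the prediction loss: `ℓ(u, v; y)` is symmetric in `u, v`, twice differentiable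
in `(u, v)`, and `‖∇²_{uu} ℓ‖₂ ≤ L`, `‖∇²_{uv} ℓ‖₂ ≤ L` everywhere (spectral norms). -/
structure SmoothLoss (P : Problem U V d) (L : ℝ) : Prop where
  symm : ∀ u v y, P.loss u v y = P.loss v u y
  differentiable : ∀ y, Differentiable ℝ (fun z : Emb d × Emb d => P.loss z.1 z.2 y)
  differentiable_fderiv :
    ∀ y, Differentiable ℝ (fderiv ℝ (fun z : Emb d × Emb d => P.loss z.1 z.2 y))
  hess_uu : ∀ u v y, ‖fderiv ℝ (fun u' => P.gradFst u' v y) u‖ ≤ L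
  hess_uv : ∀ u v y, ‖fderiv ℝ (fun v' => P.gradFst u v' y) v‖ ≤ L

/-- `∑_{l ∈ X} p_l σ_l²`. -/
def noise (P : Problem U V d) (σ : U ⊕ V → ℝ) : ℝ := ∑ l, P.freq l * σ l ^ 2

/-- `M_f = f(Θ⁰) - f* + ∑_{k ∈ X} p_k σ_k² / L`. -/
def Mf (P : Problem U V d) (L : ℝ) (σ : U ⊕ V → ℝ) (Θ₀ : Params U V d) : ℝ :=
  P.obj Θ₀ - P.optVal + ∑ k, P.freq k * σ k ^ 2 / L

/-- `α = √(M_f / (L ∑_{l ∈ X} p_l σ_l²))`. -/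
def stepConst (P : Problem U V d) (L : ℝ) (σ : U ⊕ V → ℝ) (Θ₀ : Params U V d) : ℝ :=
  √(P.Mf L σ Θ₀ / (L * P.noise σ))

end Problem

open Classical in
/-- The counters: `c_k^t` is the number of iterations before `t` whose sampled pair contains `k`. -/
def counter (z : ℕ → U × V) : ℕ → U ⊕ V → ℕ
  | 0, _ => 0
  | t + 1, k =>
      counter z t k + if k = Sum.inl (z t).1 ∨ k = Sum.inr (z t).2 then 1 else 0

/-- The counter-based learning rate `min {1 / (4L), α / √(T p̂)}` with `p̂ = c / t`, where the
second entry is `+∞` for a token that has not been sampled so far (`c = 0`). -/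
def counterRate (L α : ℝ) (T t c : ℕ) : ℝ :=
  if c = 0 then 1 / (4 * L)
  else min (1 / (4 * L)) (α / √((T : ℝ) * ((c : ℝ) / (t : ℝ))))

/-- The iterates `Θ^t` of counter-based frequency-aware SGD along the sample sequence `z`:
`θ_k^{t+1} = θ_k^t - η̂_k^t(c_k^t) g_k^t`, where `g_k^t = 0` for the tokens not sampled at `t`. -/
def cfsgd (P : Problem U V d) (L α : ℝ) (T : ℕ) (Θ₀ : Params U V d) (z : ℕ → U × V) :
    ℕ → Params U V d
  | 0 => Θ₀
  | t + 1 =>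
      WithLp.toLp 2 fun k =>
        cfsgd P L α T Θ₀ z t k
          - counterRate L α T t (counter z t k) • P.stochGrad (cfsgd P L α T Θ₀ z t) (z t) k

/-- The law of the output index `τ`: uniform on the integers `t` with `T / 2 ≤ t ≤ T`. -/
def outputLaw (T : ℕ) : PMF ℕ :=
  PMF.uniformOfFinset (Finset.Icc ((T + 1) / 2) T) (Finset.nonempty_Icc.2 (by omega))

end FreqSGD

end

open FreqSGD

/-!
Along the run the gap `f(Θ^t) - f*` is tracked with the weight `1 + ν c_k^t`, where `c_k^t` counts
the samples of the token `k`.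

The Hessian of `f` is dominated by the diagonal form `2 L ∑ p_l ‖h_l‖²` (`Problem.obj_add_le`), and
the row `l` of the stochastic gradient has second moment at most `‖∇f_l‖² / p_l + p_l σ_l²`. So one
step with rates `η̂_l ≤ 1 / (4L)` decreases `f` in expectation by a multiple of `∑ η̂_l ‖∇f_l‖²`, up
to the noise `L ∑ p_l² σ_l² η̂_l²`. The noise is controlled by `𝔼[1 / (c_l^t + 1)] ≤ 1 / ((t+1) p_l)`,
which gives `𝔼[(η̂_l^t)²] ≲ α² / (T p_l)`, and by `∑_t P(c_l^t = 0) ≤ 1 / p_l` for the steps at which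
`l` has not been sampled yet; the latter account for the term `∑ p_l σ_l² / L` in `M_f`
(`sum_integral_counterRate_sq_le`).

The rate `η̂_k^t` is too small on the unlikely paths that sample `k` far too often. Cutting these
paths off and bounding the gradient on them by a constant does not scale with `ℓ` as the two sides
of the claim do. Instead, for `ν = 1 / (p_k T)`, the weight satisfies
`1 / η̂_k^t ≤ (4L + √(2 p_k T) / α) (1 + ν c_k^t)` for `t ≥ T / 2` (`one_le_mul_counterRate`), and
the descent survives the weighting (`Problem.weighted_descent`): the extra term is `ν` times an
expectation over the event that `k` is sampled, on which the second-order terms carry a factor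
`p_k` (`Problem.neg_inner_gradient_sum_hit_le`), and `T` of these sum to order `M_f`. This needs
`ν ≤ 1 / 5`, that is `p_k T ≥ 5`. For `p_k T ≤ 5` the bound `‖∇f_k‖² ≤ 4 L p_k (f - f*)`
(`Problem.sq_norm_gradient_le`) together with `𝔼[f(Θ^t) - f*] ≤ 9 M_f` (`integral_gap_le`, the case
`ν = 0`) is already of order `L M_f / T`.
-/

namespace FreqSGD

/-! ### Smoothness of the prediction loss -/

namespace Problem

section Smoothness

variable {U V : Type*} {d : ℕ} {P : Problem U V d} {L : ℝ}

lemma gradSnd_eq_gradFst (h : P.SmoothLoss L) (u v : Emb d) (y : ℤˣ) :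
    P.gradSnd u v y = P.gradFst v u y := by
  unfold gradSnd gradFst
  congr 1
  funext v'
  exact h.symm _ _ _

lemma hasFDerivAt_loss (h : P.SmoothLoss L) (u v : Emb d) (y : ℤˣ) :
    HasFDerivAt (fun z : Emb d × Emb d => P.loss z.1 z.2 y)
      ((innerSL ℝ (P.gradFst u v y)).comp (ContinuousLinearMap.fst ℝ _ _)
        + (innerSL ℝ (P.gradSnd u v y)).comp (ContinuousLinearMap.snd ℝ _ _)) (u, v) := by
  have hF := (h.differentiable y (u, v)).hasFDerivAt
  set A := fderiv ℝ (fun z : Emb d × Emb d => P.loss z.1 z.2 y) (u, v)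
  have h1 : HasFDerivAt (fun u' => P.loss u' v y) (A.comp (ContinuousLinearMap.inl ℝ _ _)) u :=
    hF.comp (f := fun x => (x, v)) u (hasFDerivAt_prodMk_left (𝕜 := ℝ) u v)
  have h2 : HasFDerivAt (fun v' => P.loss u v' y) (A.comp (ContinuousLinearMap.inr ℝ _ _)) v :=
    hF.comp (f := fun x => (u, x)) v (hasFDerivAt_prodMk_right (𝕜 := ℝ) u v)
  have g1 := h1.differentiableAt.hasGradientAt.hasFDerivAt.unique h1
  have g2 := h2.differentiableAt.hasGradientAt.hasFDerivAt.unique h2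
  convert hF using 1
  ext z
  · have := congrArg (fun B => B z) g1
    simpa [gradFst] using this
  · have := congrArg (fun B => B z) g2
    simpa [gradSnd] using this

/-- The coordinates of `∇_u ℓ` are partial derivatives of `ℓ`. In particular the bounds on the
Hessian blocks are not about the value `0` that `fderiv` takes at points of non-differentiability. -/
lemma differentiable_gradFst (h : P.SmoothLoss L) (y : ℤˣ) :
    Differentiable ℝ (fun z : Emb d × Emb d => P.gradFst z.1 z.2 y) := by
  rw [differentiable_euclidean]
  intro i
  have key : (fun z : Emb d × Emb d => P.gradFst z.1 z.2 y i)
      = fun z => fderiv ℝ (fun z : Emb d × Emb d => P.loss z.1 z.2 y) z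
          (EuclideanSpace.single i 1, 0) := by
    funext z
    rw [(hasFDerivAt_loss h z.1 z.2 y).fderiv]
    simp [EuclideanSpace.inner_single_right]
  rw [key]
  exact (h.differentiable_fderiv y).clm_apply (differentiable_const _)

lemma norm_gradFst_sub_le (h : P.SmoothLoss L) (u v u' v' : Emb d) (y : ℤˣ) :
    ‖P.gradFst u' v' y - P.gradFst u v y‖ ≤ L * (‖u' - u‖ + ‖v' - v‖) := by
  have h1 : ‖P.gradFst u' v' y - P.gradFst u v' y‖ ≤ L * ‖u' - u‖ :=
    convex_univ.norm_image_sub_le_of_norm_fderiv_le (𝕜 := ℝ)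
      (f := fun x => P.gradFst x v' y)
      (fun x _ => ((differentiable_gradFst h y).comp
        (differentiable_id.prodMk (differentiable_const v'))) x)
      (fun x _ => h.hess_uu x v' y) (Set.mem_univ _) (Set.mem_univ _)
  have h2 : ‖P.gradFst u v' y - P.gradFst u v y‖ ≤ L * ‖v' - v‖ :=
    convex_univ.norm_image_sub_le_of_norm_fderiv_le (𝕜 := ℝ)
      (f := fun x => P.gradFst u x y)
      (fun x _ => ((differentiable_gradFst h y).comp
        ((differentiable_const u).prodMk differentiable_id)) x)
      (fun x _ => h.hess_uv u x y) (Set.mem_univ _) (Set.mem_univ _)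
  calc _ = ‖(P.gradFst u' v' y - P.gradFst u v' y)
        + (P.gradFst u v' y - P.gradFst u v y)‖ := by congr 1; abel
    _ ≤ _ := (norm_add_le _ _).trans (by linarith)

/-- Quadratic upper bound for the loss of one pair. Both partial gradients move by at most
`L s (‖a‖ + ‖b‖)` up to time `s` along the segment, which integrates to
`L (‖a‖ + ‖b‖)² / 2 ≤ L (‖a‖² + ‖b‖²)`. -/
lemma loss_add_le (h : P.SmoothLoss L) (hL : 0 ≤ L) (u v a b : Emb d) (y : ℤˣ) :
    P.loss (u + a) (v + b) y ≤ P.loss u v y + inner ℝ (P.gradFst u v y) a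
      + inner ℝ (P.gradSnd u v y) b + L * (‖a‖ ^ 2 + ‖b‖ ^ 2) := by
  set c : ℝ := inner ℝ (P.gradFst u v y) a + inner ℝ (P.gradSnd u v y) b with hc
  set M : ℝ := L * (‖a‖ ^ 2 + ‖b‖ ^ 2) with hM
  have hder : ∀ s : ℝ, HasDerivAt
      (fun s : ℝ => P.loss (u + s • a) (v + s • b) y - c * s - M * s ^ 2)
      (inner ℝ (P.gradFst (u + s • a) (v + s • b) y) a
        + inner ℝ (P.gradSnd (u + s • a) (v + s • b) y) b - c * 1
        - M * (2 * s)) s := by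
    intro s
    have hline : HasDerivAt (fun s : ℝ => (u + s • a, v + s • b)) (a, b) s := by
      have h1 : HasDerivAt (fun s : ℝ => u + s • a) a s := by
        simpa using ((hasDerivAt_id s).smul_const a).const_add u
      have h2 : HasDerivAt (fun s : ℝ => v + s • b) b s := by
        simpa using ((hasDerivAt_id s).smul_const b).const_add v
      exact h1.prodMk h2
    have h3 := (hasFDerivAt_loss h (u + s • a) (v + s • b) y).comp_hasDerivAt s hline
    have h4 := (h3.sub ((hasDerivAt_id s).const_mul c)).sub ((hasDerivAt_pow 2 s).const_mul M)
    simp only [pow_one, Nat.cast_ofNat, Nat.reduceSub, add_apply,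
      ContinuousLinearMap.coe_comp, Function.comp_apply, ContinuousLinearMap.coe_fst',
      ContinuousLinearMap.coe_snd', innerSL_apply_apply] at h4
    exact h4
  have hanti : AntitoneOn
      (fun s : ℝ => P.loss (u + s • a) (v + s • b) y - c * s - M * s ^ 2) (Set.Icc 0 1) := by
    refine antitoneOn_of_deriv_nonpos (convex_Icc 0 1)
      (fun s _ => (hder s).continuousAt.continuousWithinAt)
      (fun s _ => (hder s).differentiableAt.differentiableWithinAt) ?_
    intro s hs
    rw [interior_Icc] at hs
    have hs0 : 0 ≤ s := hs.1.le
    rw [(hder s).deriv, hc, gradSnd_eq_gradFst h, gradSnd_eq_gradFst h]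
    have e1 : inner ℝ (P.gradFst (u + s • a) (v + s • b) y) a - inner ℝ (P.gradFst u v y) a
        ≤ L * (s * ‖a‖ + s * ‖b‖) * ‖a‖ := by
      rw [← inner_sub_left]
      refine (real_inner_le_norm _ _).trans (mul_le_mul_of_nonneg_right ?_ (norm_nonneg _))
      simpa [norm_smul, abs_of_nonneg hs0] using
        norm_gradFst_sub_le h u v (u + s • a) (v + s • b) y
    have e2 : inner ℝ (P.gradFst (v + s • b) (u + s • a) y) b - inner ℝ (P.gradFst v u y) b
        ≤ L * (s * ‖b‖ + s * ‖a‖) * ‖b‖ := by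
      rw [← inner_sub_left]
      refine (real_inner_le_norm _ _).trans (mul_le_mul_of_nonneg_right ?_ (norm_nonneg _))
      simpa [norm_smul, abs_of_nonneg hs0] using
        norm_gradFst_sub_le h v u (v + s • b) (u + s • a) y
    have e3 : 0 ≤ L * s * (‖a‖ - ‖b‖) ^ 2 := by positivity
    rw [hM]
    nlinarith [e1, e2, e3]
  have := hanti (Set.left_mem_Icc.2 zero_le_one) (Set.right_mem_Icc.2 zero_le_one) zero_le_one
  simp only [one_smul, zero_smul, add_zero] at this
  linarith

end Smoothness

end Problem

/-! ### Sampling a pair, and the gradient of the objective -/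

open Classical in
/-- The indicator of the event that the token `k` belongs to the pair `w`. -/
noncomputable def hit {U V : Type*} (k : U ⊕ V) (w : U × V) : ℝ :=
  if k = Sum.inl w.1 ∨ k = Sum.inr w.2 then 1 else 0

lemma hit_nonneg {U V : Type*} (k : U ⊕ V) (w : U × V) : 0 ≤ hit k w := by
  unfold hit; split_ifs <;> norm_num

lemma hit_le_one {U V : Type*} (k : U ⊕ V) (w : U × V) : hit k w ≤ 1 := by
  unfold hit; split_ifs <;> norm_num

namespace Problem

lemma prob_nonneg {U V : Type*} {d : ℕ} (P : Problem U V d) (i : U) (j : V) :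
    0 ≤ P.prob i j := ENNReal.toReal_nonneg

variable {U V : Type*} [Fintype U] [Fintype V] {d : ℕ} {P : Problem U V d} {L : ℝ}

lemma sum_prob (P : Problem U V d) : ∑ w : U × V, P.prob w.1 w.2 = 1 := by
  have h := P.D.tsum_coe
  rw [tsum_fintype] at h
  unfold prob
  rw [← ENNReal.toReal_sum (fun w _ => P.D.apply_ne_top w), h, ENNReal.toReal_one]

lemma freq_eq_sum_hit (P : Problem U V d) (k : U ⊕ V) :
    P.freq k = ∑ w : U × V, P.prob w.1 w.2 * hit k w := by
  classical
  rcases k with i | j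
  · simp only [freq, hit, Fintype.sum_prod_type, Sum.inl.injEq, reduceCtorEq, or_false]
    simp [Finset.sum_ite_eq]
  · simp only [freq, hit, Fintype.sum_prod_type_right, Sum.inr.injEq, reduceCtorEq, false_or]
    simp [Finset.sum_ite_eq]

lemma freq_le_one (P : Problem U V d) (k : U ⊕ V) : P.freq k ≤ 1 := by
  rw [freq_eq_sum_hit, ← P.sum_prob]
  exact Finset.sum_le_sum fun w _ =>
    mul_le_of_le_one_right (P.prob_nonneg _ _) (hit_le_one k w)

lemma sum_freq_mul (P : Problem U V d) (x : U ⊕ V → ℝ) :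
    ∑ l, P.freq l * x l
      = ∑ w : U × V, P.prob w.1 w.2 * (x (Sum.inl w.1) + x (Sum.inr w.2)) := by
  simp only [Fintype.sum_sum_type, freq, mul_add, Finset.sum_add_distrib, Finset.sum_mul]
  rw [Fintype.sum_prod_type, Fintype.sum_prod_type_right]

lemma obj_eq_sum (P : Problem U V d) (Θ : Params U V d) :
    P.obj Θ = ∑ w : U × V,
      P.prob w.1 w.2 * P.loss (Θ (Sum.inl w.1)) (Θ (Sum.inr w.2)) (P.label w.1 w.2) := by
  rw [obj, Fintype.sum_prod_type]

/-- Only the rows of the two sampled tokens enter the inner product with the sparse gradient. -/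
lemma sum_inner_stochGrad (P : Problem U V d) (Θ : Params U V d) (w : U × V)
    (h : U ⊕ V → Emb d) :
    ∑ k, inner ℝ (P.stochGrad Θ w k) (h k)
      = inner ℝ (P.gradFst (Θ (Sum.inl w.1)) (Θ (Sum.inr w.2)) (P.label w.1 w.2))
          (h (Sum.inl w.1))
        + inner ℝ (P.gradSnd (Θ (Sum.inl w.1)) (Θ (Sum.inr w.2)) (P.label w.1 w.2))
          (h (Sum.inr w.2)) := by
  classical
  rw [Fintype.sum_sum_type]
  congr 1
  · rw [Finset.sum_eq_single w.1]
    · simp [stochGrad]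
    · intro i _ hi
      simp [stochGrad, hi]
    · simp
  · rw [Finset.sum_eq_single w.2]
    · simp [stochGrad]
    · intro i _ hi
      simp [stochGrad, hi]
    · simp

lemma hasGradientAt_obj (h : P.SmoothLoss L) (Θ : Params U V d) :
    HasGradientAt P.obj
      (WithLp.toLp 2 fun k => ∑ w : U × V, P.prob w.1 w.2 • P.stochGrad Θ w k) Θ := by
  rw [hasGradientAt_iff_hasFDerivAt]
  have hobj : P.obj = fun Θ => ∑ w : U × V,
      P.prob w.1 w.2 * P.loss (Θ (Sum.inl w.1)) (Θ (Sum.inr w.2)) (P.label w.1 w.2) :=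
    funext P.obj_eq_sum
  rw [hobj]
  have hw : ∀ w : U × V, HasFDerivAt (fun Θ : Params U V d =>
      P.prob w.1 w.2 * P.loss (Θ (Sum.inl w.1)) (Θ (Sum.inr w.2)) (P.label w.1 w.2)) _ Θ :=
    fun w => ((hasFDerivAt_loss h (Θ (Sum.inl w.1)) (Θ (Sum.inr w.2)) (P.label w.1 w.2)).comp
      (f := fun Θ : Params U V d => (Θ (Sum.inl w.1), Θ (Sum.inr w.2))) Θ
      (((PiLp.proj 2 (𝕜 := ℝ) (fun _ : U ⊕ V => Emb d) (Sum.inl w.1)).hasFDerivAt).prodMk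
        ((PiLp.proj 2 (𝕜 := ℝ) (fun _ : U ⊕ V => Emb d) (Sum.inr w.2)).hasFDerivAt))).const_mul
          (P.prob w.1 w.2)
  refine (HasFDerivAt.fun_sum (u := Finset.univ) fun w _ => hw w).congr_fderiv ?_
  refine ContinuousLinearMap.ext fun η => ?_
  have e : inner ℝ (WithLp.toLp 2 fun k => ∑ w : U × V, P.prob w.1 w.2 • P.stochGrad Θ w k) η
      = ∑ w : U × V, P.prob w.1 w.2 * ∑ k, inner ℝ (P.stochGrad Θ w k) (η k) := by
    rw [PiLp.inner_apply]
    simp only [sum_inner, real_inner_smul_left, Finset.mul_sum]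
    rw [Finset.sum_comm]
  rw [InnerProductSpace.toDual_apply_apply, e]
  simp only [sum_inner_stochGrad]
  simp [mul_add]

lemma gradient_obj_apply (h : P.SmoothLoss L) (Θ : Params U V d) (k : U ⊕ V) :
    gradient P.obj Θ k = ∑ w : U × V, P.prob w.1 w.2 • P.stochGrad Θ w k := by
  rw [(hasGradientAt_obj h Θ).gradient]

/-- Quadratic upper bound for the objective: row `l` carries the smoothness constant `2 L p_l`. -/
lemma obj_add_le (h : P.SmoothLoss L) (hL : 0 ≤ L) (Θ η : Params U V d) :
    P.obj (Θ + η) ≤ P.obj Θ + ∑ l, inner ℝ (gradient P.obj Θ l) (η l)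
      + L * ∑ l, P.freq l * ‖η l‖ ^ 2 := by
  have e : ∑ l, inner ℝ (gradient P.obj Θ l) (η l)
      = ∑ w : U × V, P.prob w.1 w.2 * ∑ l, inner ℝ (P.stochGrad Θ w l) (η l) := by
    simp only [gradient_obj_apply h, sum_inner, real_inner_smul_left, Finset.mul_sum]
    rw [Finset.sum_comm]
  rw [e, sum_freq_mul, obj_eq_sum, obj_eq_sum, Finset.mul_sum, ← Finset.sum_add_distrib,
    ← Finset.sum_add_distrib]
  refine Finset.sum_le_sum fun w _ => ?_
  rw [sum_inner_stochGrad]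
  have := mul_le_mul_of_nonneg_left
    (loss_add_le h hL (Θ (Sum.inl w.1)) (Θ (Sum.inr w.2)) (η (Sum.inl w.1)) (η (Sum.inr w.2))
      (P.label w.1 w.2)) (P.prob_nonneg w.1 w.2)
  simp only [PiLp.add_apply]
  linarith

/-- A gradient step in a single row cannot go below the infimum of the objective. -/
lemma sq_norm_gradient_le (h : P.SmoothLoss L) (hL : 0 < L) (hb : BddBelow (Set.range P.obj))
    (k : U ⊕ V) (hp : 0 < P.freq k) (Θ : Params U V d) :
    ‖gradient P.obj Θ k‖ ^ 2 ≤ 4 * L * P.freq k * (P.obj Θ - P.optVal) := by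
  classical
  set g := gradient P.obj Θ k with hg
  -- the step length that minimizes the quadratic upper bound
  set s : ℝ := 1 / (2 * L * P.freq k) with hs
  set η : Params U V d := WithLp.toLp 2 (Pi.single k (-(s • g))) with hη
  have h1 := obj_add_le h hL.le Θ η
  have h2 : P.optVal ≤ P.obj (Θ + η) := ciInf_le hb _
  rw [Finset.sum_eq_single k, Finset.sum_eq_single k] at h1
  · have e1 : inner ℝ (gradient P.obj Θ k) (η k) = -(s * ‖g‖ ^ 2) := by
      simp [hη, inner_neg_right, real_inner_smul_right, ← hg]
    have e2 : ‖η k‖ ^ 2 = s ^ 2 * ‖g‖ ^ 2 := by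
      simp [hη, norm_smul, mul_pow]
    rw [e1, e2] at h1
    have e3 : L * (P.freq k * (s ^ 2 * ‖g‖ ^ 2)) = s * ‖g‖ ^ 2 / 2 := by
      rw [hs]; field_simp
    have e4 : s * ‖g‖ ^ 2 / 2 ≤ P.obj Θ - P.optVal := by linarith
    have e5 : ‖g‖ ^ 2 = 4 * L * P.freq k * (s * ‖g‖ ^ 2 / 2) := by
      rw [hs]; field_simp; ring
    rw [e5]
    exact mul_le_mul_of_nonneg_left e4 (by positivity)
  all_goals simp +contextual [hη]

lemma hit_mul_norm_stochGrad (P : Problem U V d) (Θ : Params U V d) (w : U × V) (k : U ⊕ V) :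
    hit k w * ‖P.stochGrad Θ w k‖ = ‖P.stochGrad Θ w k‖ := by
  classical
  rcases k with i | j
  · by_cases hi : i = w.1 <;> simp [hit, stochGrad, hi]
  · by_cases hj : j = w.2 <;> simp [hit, stochGrad, hj]

/-! ### Second moments of the stochastic gradient and one weighted step -/

/-- Weighted variance decomposition: `∑ q ‖x‖² = ‖m‖² + ∑ q ‖m - x‖²` for the mean `m`. -/
lemma sum_mul_sq_norm_eq {ι E : Type*} [Fintype ι] [NormedAddCommGroup E] [InnerProductSpace ℝ E]
    (q : ι → ℝ) (hq : ∑ i, q i = 1) (x : ι → E) :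
    ∑ i, q i * ‖x i‖ ^ 2 = ‖∑ i, q i • x i‖ ^ 2 + ∑ i, q i * ‖(∑ i, q i • x i) - x i‖ ^ 2 := by
  set m := ∑ i, q i • x i with hm
  have e : ∀ i, q i * ‖m - x i‖ ^ 2
      = q i * ‖m‖ ^ 2 - 2 * inner ℝ m (q i • x i) + q i * ‖x i‖ ^ 2 := by
    intro i
    rw [norm_sub_sq_real, real_inner_smul_right]; ring
  simp only [e, Finset.sum_add_distrib, Finset.sum_sub_distrib, ← Finset.sum_mul, hq,
    ← Finset.mul_sum, ← inner_sum, ← hm, real_inner_self_eq_norm_sq]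
  ring

/-- A bound on the variance under the probability weights `q / p` turns into one on the second
moment under the unnormalized weights `q`. -/
lemma sum_mul_sq_norm_le {ι E : Type*} [Fintype ι] [NormedAddCommGroup E] [InnerProductSpace ℝ E]
    (q : ι → ℝ) {p s : ℝ} {x : ι → E} {m : E} (hp : 0 < p) (hq : ∑ i, q i = p)
    (hm : m = ∑ i, q i • x i) (hs : ∑ i, q i / p * ‖(1 / p) • m - x i‖ ^ 2 ≤ s) :
    ∑ i, q i * ‖x i‖ ^ 2 ≤ ‖m‖ ^ 2 / p + p * s := by
  have h1 := sum_mul_sq_norm_eq (fun i => q i / p)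
    (by rw [← Finset.sum_div, hq, div_self hp.ne']) x
  have h2 : ∑ i, (q i / p) • x i = (1 / p) • m := by
    rw [hm, Finset.smul_sum]
    exact Finset.sum_congr rfl fun i _ => by rw [smul_smul]; congr 1; ring
  rw [h2] at h1
  have h3 : ∑ i, q i * ‖x i‖ ^ 2 = p * ∑ i, q i / p * ‖x i‖ ^ 2 := by
    rw [Finset.mul_sum]
    exact Finset.sum_congr rfl fun i _ => by field_simp
  rw [h3, h1, norm_smul, mul_pow, Real.norm_eq_abs, sq_abs, mul_add]
  exact add_le_add (le_of_eq (by field_simp)) (mul_le_mul_of_nonneg_left hs hp.le)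

/-- Second moment of a row of the sparse stochastic gradient. -/
lemma sum_prob_mul_sq_norm_stochGrad_le (h : P.SmoothLoss L) {σ : U ⊕ V → ℝ} {Θ : Params U V d}
    (hv : P.CondVarianceLE σ Θ) (hp : ∀ k, 0 < P.freq k) (k : U ⊕ V) :
    ∑ w : U × V, P.prob w.1 w.2 * ‖P.stochGrad Θ w k‖ ^ 2
      ≤ ‖gradient P.obj Θ k‖ ^ 2 / P.freq k + P.freq k * σ k ^ 2 := by
  classical
  rcases k with i | j
  · have e1 : ∑ w : U × V, P.prob w.1 w.2 * ‖P.stochGrad Θ w (Sum.inl i)‖ ^ 2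
        = ∑ j, P.prob i j * ‖P.stochGrad Θ (i, j) (Sum.inl i)‖ ^ 2 := by
      rw [Fintype.sum_prod_type, Finset.sum_eq_single i]
      · intro i' _ hi
        simp [stochGrad, hi.symm]
      · simp
    have e2 : gradient P.obj Θ (Sum.inl i)
        = ∑ j, P.prob i j • P.stochGrad Θ (i, j) (Sum.inl i) := by
      rw [gradient_obj_apply h, Fintype.sum_prod_type, Finset.sum_eq_single i]
      · intro i' _ hi
        simp [stochGrad, hi.symm]
      · simp
    rw [e1]
    exact sum_mul_sq_norm_le _ (hp _) rfl e2 (hv.1 i)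
  · have e1 : ∑ w : U × V, P.prob w.1 w.2 * ‖P.stochGrad Θ w (Sum.inr j)‖ ^ 2
        = ∑ i, P.prob i j * ‖P.stochGrad Θ (i, j) (Sum.inr j)‖ ^ 2 := by
      rw [Fintype.sum_prod_type_right, Finset.sum_eq_single j]
      · intro i' _ hi
        simp [stochGrad, hi.symm]
      · simp
    have e2 : gradient P.obj Θ (Sum.inr j)
        = ∑ i, P.prob i j • P.stochGrad Θ (i, j) (Sum.inr j) := by
      rw [gradient_obj_apply h, Fintype.sum_prod_type_right, Finset.sum_eq_single j]
      · intro i' _ hi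
        simp [stochGrad, hi.symm]
      · simp
    rw [e1]
    exact sum_mul_sq_norm_le _ (hp _) rfl e2 (hv.2 j)

/-- Correlation of a row of the stochastic gradient with the event that the token `k` is sampled:
the second-order term carries the factor `p_k`, by the Cauchy-Schwarz inequality on the event that
both tokens are sampled. -/
lemma neg_inner_gradient_sum_hit_le (h : P.SmoothLoss L) {σ : U ⊕ V → ℝ} {Θ : Params U V d}
    (hv : P.CondVarianceLE σ Θ) (hp : ∀ k, 0 < P.freq k) (k l : U ⊕ V) :
    - ∑ w : U × V, P.prob w.1 w.2 * (hit k w * inner ℝ (gradient P.obj Θ l) (P.stochGrad Θ w l))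
      ≤ ‖gradient P.obj Θ l‖ ^ 2 + P.freq k * (P.freq l * σ l ^ 2) / 2 := by
  set x := gradient P.obj Θ l with hx
  set q : ℝ := ∑ w : U × V, P.prob w.1 w.2 * (hit k w * hit l w) with hq
  set M : ℝ := ∑ w : U × V, P.prob w.1 w.2 * ‖P.stochGrad Θ w l‖ ^ 2 with hM
  set m : ℝ := ∑ w : U × V, P.prob w.1 w.2 * (hit k w * ‖P.stochGrad Θ w l‖) with hm
  have hMle := sum_prob_mul_sq_norm_stochGrad_le h hv hp l
  have hqk : q ≤ P.freq k := by
    rw [freq_eq_sum_hit]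
    exact Finset.sum_le_sum fun w _ => mul_le_mul_of_nonneg_left
      (mul_le_of_le_one_right (hit_nonneg k w) (hit_le_one l w)) (P.prob_nonneg _ _)
  have hql : q ≤ P.freq l := by
    rw [freq_eq_sum_hit]
    exact Finset.sum_le_sum fun w _ => mul_le_mul_of_nonneg_left
      (mul_le_of_le_one_left (hit_nonneg l w) (hit_le_one k w)) (P.prob_nonneg _ _)
  have hq0 : 0 ≤ q := Finset.sum_nonneg fun w _ =>
    mul_nonneg (P.prob_nonneg _ _) (mul_nonneg (hit_nonneg k w) (hit_nonneg l w))
  have hsq : ∀ (k : U ⊕ V) (w : U × V), hit k w ^ 2 = hit k w := by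
    intro k w; unfold hit; split_ifs <;> norm_num
  have hCS : m ^ 2 ≤ q * M := by
    refine Finset.sum_sq_le_sum_mul_sum_of_sq_le_mul _
      (fun w _ => mul_nonneg (P.prob_nonneg _ _) (mul_nonneg (hit_nonneg k w) (hit_nonneg l w)))
      (fun w _ => mul_nonneg (P.prob_nonneg _ _) (sq_nonneg _)) (fun w _ => le_of_eq ?_)
    have e := hit_mul_norm_stochGrad P Θ w l
    calc _ = P.prob w.1 w.2 ^ 2 * (hit k w ^ 2 * (hit l w * ‖P.stochGrad Θ w l‖) ^ 2) := by
            rw [e]; ring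
      _ = _ := by rw [mul_pow (hit l w), hsq, hsq]; ring
  have h1 : - ∑ w : U × V, P.prob w.1 w.2 * (hit k w * inner ℝ x (P.stochGrad Θ w l))
      ≤ ‖x‖ * m := by
    rw [← Finset.sum_neg_distrib, hm, Finset.mul_sum]
    refine Finset.sum_le_sum fun w _ => ?_
    have := neg_le_of_abs_le (abs_real_inner_le_norm x (P.stochGrad Θ w l))
    have h2 := mul_le_mul_of_nonneg_left this
      (mul_nonneg (P.prob_nonneg w.1 w.2) (hit_nonneg k w))
    linarith
  have h3 : q * M ≤ ‖x‖ ^ 2 + P.freq k * (P.freq l * σ l ^ 2) := by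
    calc q * M ≤ q * (‖x‖ ^ 2 / P.freq l + P.freq l * σ l ^ 2) :=
          mul_le_mul_of_nonneg_left hMle hq0
      _ = q * (‖x‖ ^ 2 / P.freq l) + q * (P.freq l * σ l ^ 2) := by ring
      _ ≤ P.freq l * (‖x‖ ^ 2 / P.freq l) + P.freq k * (P.freq l * σ l ^ 2) :=
          add_le_add
            (mul_le_mul_of_nonneg_right hql (div_nonneg (sq_nonneg _) (hp l).le))
            (mul_le_mul_of_nonneg_right hqk (mul_nonneg (hp l).le (sq_nonneg _)))
      _ = _ := by rw [mul_div_cancel₀ _ (hp l).ne']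
  nlinarith [sq_nonneg (‖x‖ - m)]

/-- Expectation of the optimality gap after one SGD step with rates `η`, weighted by
`1 + ν (c + 1[k sampled])`. The weight costs the two terms with the factor `ν p_k`; the
remaining contributions of the event that `k` is sampled are absorbed by halving the decrease and
doubling the noise, since `ν ≤ 1 / 5`. -/
lemma weighted_descent (h : P.SmoothLoss L) (hL : 0 < L) {σ : U ⊕ V → ℝ} {Θ : Params U V d}
    (hv : P.CondVarianceLE σ Θ) (hp : ∀ k, 0 < P.freq k) {η : U ⊕ V → ℝ}
    (hη0 : ∀ l, 0 ≤ η l) (hη : ∀ l, η l ≤ 1 / (4 * L)) {ν c : ℝ} (hν0 : 0 ≤ ν) (hν : ν ≤ 1 / 5)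
    (hc : 0 ≤ c) (k : U ⊕ V) :
    ∑ w : U × V, P.prob w.1 w.2 * ((1 + ν * (c + hit k w)) *
        (P.obj (WithLp.toLp 2 fun l => Θ l - η l • P.stochGrad Θ w l) - P.optVal))
      ≤ (1 + ν * c) * (P.obj Θ - P.optVal) + ν * P.freq k * (P.obj Θ - P.optVal)
        - 1 / 2 * ((1 + ν * c) * ∑ l, η l * ‖gradient P.obj Θ l‖ ^ 2)
        + 2 * ((1 + ν * c) * (L * ∑ l, P.freq l ^ 2 * σ l ^ 2 * η l ^ 2))
        + ν * P.freq k * (P.noise σ / (8 * L)) := by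
  set f := P.obj Θ - P.optVal with hf
  set x : U ⊕ V → Emb d := fun l => gradient P.obj Θ l with hx
  set S := ∑ l, η l * ‖x l‖ ^ 2 with hS
  set N := L * ∑ l, P.freq l ^ 2 * σ l ^ 2 * η l ^ 2 with hN
  set g : U × V → U ⊕ V → Emb d := fun w l => P.stochGrad Θ w l with hg
  have hS0 : 0 ≤ S := Finset.sum_nonneg fun l _ => mul_nonneg (hη0 l) (sq_nonneg _)
  have hN0 : 0 ≤ N := mul_nonneg hL.le <| Finset.sum_nonneg fun l _ => by positivity
  set A : U × V → ℝ := fun w => ∑ l, η l * inner ℝ (x l) (g w l) with hA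
  set B : U × V → ℝ := fun w => L * ∑ l, P.freq l * η l ^ 2 * ‖g w l‖ ^ 2 with hB
  have hB0 : ∀ w, 0 ≤ B w := fun w => mul_nonneg hL.le <| Finset.sum_nonneg fun l _ =>
    mul_nonneg (mul_nonneg (hp l).le (sq_nonneg _)) (sq_nonneg _)
  have step : ∀ w, P.obj (WithLp.toLp 2 fun l => Θ l - η l • P.stochGrad Θ w l) - P.optVal
      ≤ f - A w + B w := by
    intro w
    have := obj_add_le h hL.le Θ (WithLp.toLp 2 fun l => -(η l • P.stochGrad Θ w l))
    have e : (WithLp.toLp 2 fun l => Θ l - η l • P.stochGrad Θ w l : Params U V d)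
        = Θ + WithLp.toLp 2 fun l => -(η l • P.stochGrad Θ w l) := by
      ext l i; simp [sub_eq_add_neg]
    rw [e]
    simp only [inner_neg_right, real_inner_smul_right, Finset.sum_neg_distrib, norm_neg, norm_smul,
      mul_pow, Real.norm_eq_abs, sq_abs, ← mul_assoc] at this
    simp only [hA, hB, hf, hx, hg]
    linarith
  have hBsum : ∑ w : U × V, P.prob w.1 w.2 * B w ≤ S / 4 + N := by
    have e : ∑ w : U × V, P.prob w.1 w.2 * B w = L * ∑ l, P.freq l * η l ^ 2 *
        ∑ w : U × V, P.prob w.1 w.2 * ‖g w l‖ ^ 2 := by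
      simp only [hB, Finset.mul_sum]
      rw [Finset.sum_comm]
      exact Finset.sum_congr rfl fun l _ => Finset.sum_congr rfl fun w _ => by ring
    rw [e, hS, hN, Finset.mul_sum, Finset.mul_sum, Finset.sum_div, ← Finset.sum_add_distrib]
    refine Finset.sum_le_sum fun l _ => ?_
    have h1 := sum_prob_mul_sq_norm_stochGrad_le h hv hp l
    calc L * (P.freq l * η l ^ 2 * ∑ w : U × V, P.prob w.1 w.2 * ‖g w l‖ ^ 2)
        ≤ L * (P.freq l * η l ^ 2 * (‖x l‖ ^ 2 / P.freq l + P.freq l * σ l ^ 2)) := by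
          have := (hp l).le
          gcongr
      _ = (L * η l) * (η l * ‖x l‖ ^ 2) + L * (P.freq l ^ 2 * σ l ^ 2 * η l ^ 2) := by
          have := (hp l).ne'
          field_simp
      _ ≤ 1 / 4 * (η l * ‖x l‖ ^ 2) + L * (P.freq l ^ 2 * σ l ^ 2 * η l ^ 2) := by
          have h2 : L * η l ≤ 1 / 4 := by
            have := mul_le_mul_of_nonneg_left (hη l) hL.le
            rwa [show L * (1 / (4 * L)) = 1 / 4 by field_simp] at this
          have := mul_nonneg (hη0 l) (sq_nonneg ‖x l‖)
          gcongr
      _ = _ := by ring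
  have hBhit : ∑ w : U × V, P.prob w.1 w.2 * (hit k w * B w) ≤ S / 4 + N :=
    (Finset.sum_le_sum fun w _ => mul_le_mul_of_nonneg_left
      (mul_le_of_le_one_left (hB0 w) (hit_le_one k w)) (P.prob_nonneg _ _)).trans hBsum
  have hAsum : ∑ w : U × V, P.prob w.1 w.2 * A w = S := by
    simp only [hA, Finset.mul_sum]
    rw [Finset.sum_comm, hS]
    refine Finset.sum_congr rfl fun l _ => ?_
    rw [← real_inner_self_eq_norm_sq]
    conv_rhs => rw [hx]; simp only []; rw [gradient_obj_apply h Θ l, inner_sum, Finset.mul_sum]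
    refine Finset.sum_congr rfl fun w _ => ?_
    rw [← gradient_obj_apply h Θ l, real_inner_smul_right]
    ring
  have hAhit : - ∑ w : U × V, P.prob w.1 w.2 * (hit k w * A w)
      ≤ S + P.freq k * (P.noise σ / (8 * L)) := by
    have e : ∑ w : U × V, P.prob w.1 w.2 * (hit k w * A w)
        = ∑ l, η l * ∑ w : U × V, P.prob w.1 w.2 * (hit k w * inner ℝ (x l) (g w l)) := by
      simp only [hA, Finset.mul_sum]
      rw [Finset.sum_comm]
      exact Finset.sum_congr rfl fun l _ => Finset.sum_congr rfl fun w _ => by ring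
    rw [e, ← Finset.sum_neg_distrib, hS, noise, Finset.sum_div, Finset.mul_sum,
      ← Finset.sum_add_distrib]
    refine Finset.sum_le_sum fun l _ => ?_
    have h1 := mul_le_mul_of_nonneg_left (neg_inner_gradient_sum_hit_le h hv hp k l) (hη0 l)
    have h2 : 0 ≤ P.freq k * (P.freq l * σ l ^ 2) / 2 :=
      div_nonneg (mul_nonneg (hp k).le (mul_nonneg (hp l).le (sq_nonneg _))) (by norm_num)
    have h3 := mul_le_mul_of_nonneg_right (hη l) h2
    have h4 : 1 / (4 * L) * (P.freq k * (P.freq l * σ l ^ 2) / 2)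
        = P.freq k * (P.freq l * σ l ^ 2 / (8 * L)) := by field_simp; ring
    rw [h4] at h3
    simp only [hx, hg]
    linarith
  have total : ∑ w : U × V, P.prob w.1 w.2 * ((1 + ν * (c + hit k w)) *
        (P.obj (WithLp.toLp 2 fun l => Θ l - η l • P.stochGrad Θ w l) - P.optVal))
      ≤ ∑ w : U × V, P.prob w.1 w.2 * ((1 + ν * (c + hit k w)) * (f - A w + B w)) :=
    Finset.sum_le_sum fun w _ => mul_le_mul_of_nonneg_left
      (mul_le_mul_of_nonneg_left (step w)
        (by have := hit_nonneg k w; positivity)) (P.prob_nonneg _ _)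
  have expand : ∑ w : U × V, P.prob w.1 w.2 * ((1 + ν * (c + hit k w)) * (f - A w + B w))
      = (1 + ν * c) * (f * ∑ w : U × V, P.prob w.1 w.2
            - ∑ w : U × V, P.prob w.1 w.2 * A w + ∑ w : U × V, P.prob w.1 w.2 * B w)
        + ν * (f * ∑ w : U × V, P.prob w.1 w.2 * hit k w
            - ∑ w : U × V, P.prob w.1 w.2 * (hit k w * A w)
            + ∑ w : U × V, P.prob w.1 w.2 * (hit k w * B w)) := by
    simp only [Finset.mul_sum, ← Finset.sum_sub_distrib, ← Finset.sum_add_distrib]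
    exact Finset.sum_congr rfl fun w _ => by ring
  rw [expand, sum_prob, ← freq_eq_sum_hit, hAsum] at total
  have hc1 : 0 ≤ 1 + ν * c := by positivity
  have t1 := mul_le_mul_of_nonneg_left hBsum hc1
  have t2 := mul_le_mul_of_nonneg_left hBhit hν0
  have t3 := mul_le_mul_of_nonneg_left hAhit hν0
  have t4 : ν * S ≤ 1 / 5 * ((1 + ν * c) * S) := by
    have : ν * S ≤ 1 / 5 * S := mul_le_mul_of_nonneg_right hν hS0
    nlinarith [mul_nonneg (mul_nonneg hν0 hc) hS0]
  have t5 : ν * N ≤ (1 + ν * c) * N := by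
    refine mul_le_mul_of_nonneg_right ?_ hN0
    nlinarith [mul_nonneg hν0 hc]
  linarith

end Problem

/-! ### Functionals of independent samples -/

section Sampling

variable {α Ω : Type*} [MeasurableSpace Ω] {μ : Measure Ω} {ξ : ℕ → Ω → α} {D : PMF α}

lemma dependsOn_update {β : Type*} {F : (ℕ → α) → β} {t : ℕ} (hF : DependsOn F (Set.Iio (t + 1)))
    (a : α) : DependsOn (fun z => F (Function.update z t a)) (Set.Iio t) := by
  intro x y h
  refine hF fun i hi => ?_
  rcases eq_or_ne i t with rfl | hne
  · simp
  · simp only [Function.update_of_ne hne]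
    exact h i (lt_of_le_of_ne (Nat.lt_succ_iff.1 hi) hne)

lemma _root_.DependsOn.fun_mul {α : Type*} {s : Set ℕ} {F G : (ℕ → α) → ℝ}
    (hF : DependsOn F s) (hG : DependsOn G s) : DependsOn (fun z => F z * G z) s :=
  fun x y h => by simp only [hF h, hG h]

lemma exists_bound_of_dependsOn [Finite α] {F : (ℕ → α) → ℝ} {t : ℕ} (hF : DependsOn F (Set.Iio t)) :
    ∃ C, ∀ z, ‖F z‖ ≤ C := by
  obtain ⟨g, rfl⟩ := dependsOn_iff_exists_comp.1 hF
  obtain ⟨C, hC⟩ := (Set.finite_range fun y => ‖g y‖).bddAbove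
  exact ⟨C, fun z => hC ⟨_, rfl⟩⟩

variable [MeasurableSpace α]

/-- The samples `ξ 0, ξ 1, …` are independent with law `D`. -/
structure IIDSamples (D : PMF α) (ξ : ℕ → Ω → α) (μ : Measure Ω) : Prop where
  measurable : ∀ t, Measurable (ξ t)
  map_eq : ∀ t, μ.map (ξ t) = D.toMeasure
  indep : iIndepFun ξ μ

lemma IIDSamples.measurable_path (hξ : IIDSamples D ξ μ) : Measurable fun ω t => ξ t ω :=
  measurable_pi_lambda _ hξ.measurable

variable [Fintype α] [MeasurableSingletonClass α]

lemma measurable_of_dependsOn {F : (ℕ → α) → ℝ} {t : ℕ} (hF : DependsOn F (Set.Iio t)) :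
    Measurable F := by
  obtain ⟨g, rfl⟩ := dependsOn_iff_exists_comp.1 hF
  exact (measurable_of_finite g).comp
    (measurable_pi_lambda _ fun i => measurable_pi_apply (i : ℕ))

/-- Functionals of finitely many samples from a finite set take finitely many values. -/
lemma IIDSamples.integrable [IsFiniteMeasure μ] (hξ : IIDSamples D ξ μ) {F : (ℕ → α) → ℝ} {t : ℕ}
    (hF : DependsOn F (Set.Iio t)) : Integrable (fun ω => F fun s => ξ s ω) μ := by
  obtain ⟨C, hC⟩ := exists_bound_of_dependsOn hF
  exact Integrable.of_bound
    ((measurable_of_dependsOn hF).comp hξ.measurable_path).aestronglyMeasurable C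
    (Filter.Eventually.of_forall fun ω => hC _)

/-- Conditioning on the first `t` samples: the sample at time `t` may be averaged out. -/
lemma IIDSamples.integral_eq_integral_update [IsFiniteMeasure μ] (hξ : IIDSamples D ξ μ)
    {F : (ℕ → α) → ℝ} {t : ℕ} (hF : DependsOn F (Set.Iio (t + 1))) :
    ∫ ω, F (fun s => ξ s ω) ∂μ
      = ∫ ω, ∑ a, (D a).toReal * F (Function.update (fun s => ξ s ω) t a) ∂μ := by
  classical
  have hpt : ∀ ω, F (fun s => ξ s ω) = ∑ a, (Set.indicator {a} (fun _ => (1 : ℝ)) (ξ t ω))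
      * F (Function.update (fun s => ξ s ω) t a) := by
    intro ω
    rw [Finset.sum_eq_single (ξ t ω)]
    · simp
    · intro a _ ha
      simp [Set.indicator, ha.symm]
    · simp
  have hint : ∀ a, Integrable (fun ω => F (Function.update (fun s => ξ s ω) t a)) μ :=
    fun a => hξ.integrable (dependsOn_update hF a)
  have hterm : ∀ a, ∫ ω, (Set.indicator {a} (fun _ => (1 : ℝ)) (ξ t ω))
      * F (Function.update (fun s => ξ s ω) t a) ∂μ
      = (D a).toReal * ∫ ω, F (Function.update (fun s => ξ s ω) t a) ∂μ := by
    intro a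
    have hdep : DependsOn (fun z => F (Function.update z t a)) (Finset.range t : Set ℕ) := by
      rw [Finset.coe_range]; exact dependsOn_update hF a
    obtain ⟨g, hg⟩ := dependsOn_iff_exists_comp.1 hdep
    have hind := hξ.indep.indepFun_finset {t} (Finset.range t) (by simp) hξ.measurable
    have hm1 : Measurable fun y : (({t} : Finset ℕ) → α) =>
        Set.indicator {a} (fun _ => (1 : ℝ)) (y ⟨t, by simp⟩) :=
      (measurable_const.indicator (measurableSet_singleton a)).comp (measurable_pi_apply _)
    have hm2 : Measurable g := measurable_of_finite g
    have h1 := (hind.comp hm1 hm2).integral_fun_mul_eq_mul_integral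
      ((hm1.comp (measurable_pi_lambda _ fun i => hξ.measurable i)).aestronglyMeasurable)
      ((hm2.comp (measurable_pi_lambda _ fun i => hξ.measurable i)).aestronglyMeasurable)
    have h2 : ∀ ω, F (Function.update (fun s => ξ s ω) t a)
        = g (fun i : Finset.range t => ξ i ω) := fun ω => congrFun hg (fun s => ξ s ω)
    have h3 : ∫ ω, Set.indicator {a} (fun _ => (1 : ℝ)) (ξ t ω) ∂μ = (D a).toReal := by
      rw [← integral_map (φ := ξ t) (hξ.measurable t).aemeasurable
        (measurable_const.indicator (measurableSet_singleton a)).aestronglyMeasurable,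
        hξ.map_eq, integral_indicator_const _ (measurableSet_singleton a), smul_eq_mul, mul_one,
        Measure.real, PMF.toMeasure_apply_singleton _ _ (measurableSet_singleton a)]
    simp only [h2]
    rw [← h3]
    exact h1
  simp_rw [hpt]
  rw [integral_finsetSum, integral_finsetSum]
  · refine Finset.sum_congr rfl fun a _ => ?_
    rw [hterm, integral_const_mul]
  · exact fun a _ => (hint a).const_mul _
  · intro a _
    refine (hint a).bdd_mul (c := 1) ?_ ?_
    · exact ((measurable_const.indicator (measurableSet_singleton a)).comp
        (hξ.measurable t)).aestronglyMeasurable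
    · refine Filter.Eventually.of_forall fun ω => ?_
      by_cases h : ξ t ω = a <;> simp [Set.indicator, h]

end Sampling

/-! ### Counters and learning rates -/

section Counters

variable {U V : Type*}

lemma counter_succ (z : ℕ → U × V) (t : ℕ) (k : U ⊕ V) :
    (counter z (t + 1) k : ℝ) = counter z t k + hit k (z t) := by
  classical
  rw [counter, hit]
  split_ifs <;> simp

lemma dependsOn_counter (t : ℕ) :
    DependsOn (fun z : ℕ → U × V => counter z t) (Set.Iio t) := by
  induction t with
  | zero => intro x y _; funext k; rfl
  | succ t ih =>
    intro x y h
    have h1 : counter x t = counter y t := ih fun i hi => h i (Nat.lt_succ_of_lt hi)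
    have h2 : x t = y t := h t (Nat.lt_succ_self t)
    funext k
    change counter x (t + 1) k = counter y (t + 1) k
    rw [counter, counter, h1, h2]

lemma counter_update (z : ℕ → U × V) (t : ℕ) (w : U × V) :
    counter (Function.update z t w) t = counter z t :=
  dependsOn_counter t fun _ hi => Function.update_of_ne (ne_of_lt hi) _ _

lemma counter_update_succ (z : ℕ → U × V) (t : ℕ) (w : U × V) (k : U ⊕ V) :
    (counter (Function.update z t w) (t + 1) k : ℝ) = counter z t k + hit k w := by
  rw [counter_succ, counter_update, Function.update_self]

lemma counter_le (z : ℕ → U × V) (t : ℕ) (k : U ⊕ V) : counter z t k ≤ t := by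
  induction t with
  | zero => rfl
  | succ t ih => rw [counter]; split_ifs <;> omega

lemma pow_counter_update_succ (x : ℝ) (z : ℕ → U × V) (t : ℕ) (w : U × V) (k : U ⊕ V) :
    x ^ counter (Function.update z t w) (t + 1) k
      = x ^ counter z t k * (1 - hit k w + x * hit k w) := by
  classical
  rw [counter, counter_update, Function.update_self, hit]
  split_ifs <;> simp [pow_succ]

/-- The weight `1 + ν c_k^t`. For `ν = 1 / (p_k T)` and `t ≥ T / 2` it dominates `1 / η̂_k^t` up to
a deterministic factor, which makes up for the paths on which the token `k` is sampled far too often and its learning rate is too small. -/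
noncomputable def weight (ν : ℝ) (k : U ⊕ V) (t : ℕ) (z : ℕ → U × V) : ℝ :=
  1 + ν * counter z t k

lemma dependsOn_weight {ν : ℝ} (k : U ⊕ V) (t : ℕ) : DependsOn (weight ν k t) (Set.Iio t) :=
  fun x y h => by
    have h2 : counter x t = counter y t := dependsOn_counter t h
    rw [weight, weight, h2]

lemma one_le_weight {ν : ℝ} (hν : 0 ≤ ν) (k : U ⊕ V) (t : ℕ) (z : ℕ → U × V) : 1 ≤ weight ν k t z := by
  unfold weight
  have : 0 ≤ ν * (counter z t k : ℝ) := by positivity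
  linarith

variable [Fintype U] [Fintype V] {d : ℕ}

lemma sum_prob_mul_pow (P : Problem U V d) (x : ℝ) (l : U ⊕ V) :
    ∑ w : U × V, P.prob w.1 w.2 * (1 - hit l w + x * hit l w)
      = 1 - P.freq l + P.freq l * x := by
  calc _ = ∑ w : U × V, P.prob w.1 w.2 - ∑ w : U × V, P.prob w.1 w.2 * hit l w
        + (∑ w : U × V, P.prob w.1 w.2 * hit l w) * x := by
        rw [Finset.sum_mul, ← Finset.sum_sub_distrib, ← Finset.sum_add_distrib]
        exact Finset.sum_congr rfl fun w _ => by ring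
    _ = _ := by rw [P.sum_prob, ← P.freq_eq_sum_hit]

variable {P : Problem U V d}
  [MeasurableSpace U] [DiscreteMeasurableSpace U] [MeasurableSpace V] [DiscreteMeasurableSpace V]
  {Ω : Type*} [MeasurableSpace Ω] {μ : Measure Ω} [IsProbabilityMeasure μ] {ξ : ℕ → Ω → U × V}

/-- Generating function of the counter, a binomial variable. -/
lemma integral_pow_counter (hξ : IIDSamples P.D ξ μ) (l : U ⊕ V) (x : ℝ) (t : ℕ) :
    ∫ ω, x ^ counter (fun s => ξ s ω) t l ∂μ = (1 - P.freq l + P.freq l * x) ^ t := by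
  induction t with
  | zero => simp [counter]
  | succ t ih =>
    have hdep : DependsOn (fun z : ℕ → U × V => x ^ counter z (t + 1) l) (Set.Iio (t + 1)) :=
      fun y z h => by simp only [dependsOn_counter (t + 1) h]
    rw [hξ.integral_eq_integral_update hdep, pow_succ, ← ih, ← integral_mul_const]
    congr 1
    funext ω
    rw [← sum_prob_mul_pow, Finset.mul_sum]
    refine Finset.sum_congr rfl fun w _ => ?_
    rw [pow_counter_update_succ, Problem.prob]
    ring

/-- Bound for `𝔼[c_k x ^ c_l]`: one of the `t` samples is used up by an occurrence of `k`, the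
others contribute a factor of the generating function each. For `t = 0` the truncated exponent
`t - 1` is harmless, as both sides vanish. -/
lemma integral_counter_mul_pow_counter_le (hξ : IIDSamples P.D ξ μ) (k l : U ⊕ V) {x : ℝ}
    (hx0 : 0 ≤ x) (hx1 : x ≤ 1) (t : ℕ) :
    ∫ ω, counter (fun s => ξ s ω) t k * x ^ counter (fun s => ξ s ω) t l ∂μ
      ≤ t * P.freq k * (1 - P.freq l + P.freq l * x) ^ (t - 1) := by
  set r := 1 - P.freq l + P.freq l * x with hr
  induction t with
  | zero => simp [counter]
  | succ t ih =>
    have hdep : DependsOn (fun z : ℕ → U × V => (counter z (t + 1) k : ℝ) *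
        x ^ counter z (t + 1) l) (Set.Iio (t + 1)) :=
      fun y z h => by simp only [dependsOn_counter (t + 1) h]
    have hdep1 : DependsOn (fun z : ℕ → U × V => (counter z t k : ℝ) * x ^ counter z t l)
        (Set.Iio t) := fun y z h => by simp only [dependsOn_counter t h]
    have hdep2 : DependsOn (fun z : ℕ → U × V => x ^ counter z t l)
        (Set.Iio t) := fun y z h => by simp only [dependsOn_counter t h]
    have hr0 : 0 ≤ r := by
      have := P.freq_le_one l
      have : 0 ≤ P.freq l := by
        rw [P.freq_eq_sum_hit]
        exact Finset.sum_nonneg fun w _ => mul_nonneg (P.prob_nonneg _ _) (hit_nonneg _ _)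
      have := mul_nonneg this hx0
      linarith
    rw [hξ.integral_eq_integral_update hdep]
    calc _ ≤ ∫ ω, ((counter (fun s => ξ s ω) t k : ℝ) * x ^ counter (fun s => ξ s ω) t l * r
            + x ^ counter (fun s => ξ s ω) t l * P.freq k) ∂μ := by
          refine integral_mono (hξ.integrable (t := t)
            (F := fun z => ∑ w : U × V, (P.D w).toReal *
              ((counter (Function.update z t w) (t + 1) k : ℝ) *
                x ^ counter (Function.update z t w) (t + 1) l)) fun y z h => ?_)
            (((hξ.integrable hdep1).mul_const r).add ((hξ.integrable hdep2).mul_const _))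
            fun ω => ?_
          · refine Finset.sum_congr rfl fun w _ => ?_
            exact congrArg _ (dependsOn_update hdep w h)
          · simp only
            rw [hr, ← sum_prob_mul_pow, P.freq_eq_sum_hit k, Finset.mul_sum, Finset.mul_sum,
              ← Finset.sum_add_distrib]
            refine Finset.sum_le_sum fun w _ => ?_
            rw [pow_counter_update_succ, counter_update_succ]
            have h1 : 1 - hit l w + x * hit l w ≤ 1 := by
              nlinarith [hit_nonneg l w]
            have h2 : 0 ≤ P.prob w.1 w.2 * hit k w * x ^ counter (fun s => ξ s ω) t l :=
              mul_nonneg (mul_nonneg (P.prob_nonneg _ _) (hit_nonneg _ _))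
                (pow_nonneg hx0 _)
            have h3 := mul_le_mul_of_nonneg_left h1 h2
            change P.prob w.1 w.2 * _ ≤ _
            linarith
      _ = (∫ ω, (counter (fun s => ξ s ω) t k : ℝ) * x ^ counter (fun s => ξ s ω) t l ∂μ) * r
            + r ^ t * P.freq k := by
          rw [integral_add ((hξ.integrable hdep1).mul_const _) ((hξ.integrable hdep2).mul_const _),
            integral_mul_const, integral_mul_const, integral_pow_counter hξ, ← hr]
      _ ≤ (t * P.freq k * r ^ (t - 1)) * r + r ^ t * P.freq k := by gcongr
      _ = _ := by
          rcases t with _ | t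
          · simp
          · simp only [Nat.add_sub_cancel]
            push_cast
            ring

/-- Passing from a bound on `𝔼[H x ^ c]` to one on `𝔼[H / (c + 1)]`, by integrating in `x`. -/
lemma integral_div_counter_add_one_le (hξ : IIDSamples P.D ξ μ) (l : U ⊕ V) (t : ℕ)
    {H : (ℕ → U × V) → ℝ} (hH : DependsOn H (Set.Iio t)) {B : ℝ → ℝ} (hB : Continuous B)
    (hle : ∀ x, 0 ≤ x → x ≤ 1 →
      ∫ ω, H (fun s => ξ s ω) * x ^ counter (fun s => ξ s ω) t l ∂μ ≤ B x) :
    ∫ ω, H (fun s => ξ s ω) / (counter (fun s => ξ s ω) t l + 1) ∂μ ≤ ∫ x in (0 : ℝ)..1, B x := by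
  set b : ℕ → ℝ := fun n => ∫ ω, H (fun s => ξ s ω) *
    (if counter (fun s => ξ s ω) t l = n then 1 else 0) ∂μ with hb
  have key : ∀ φ : ℕ → ℝ, ∫ ω, H (fun s => ξ s ω) * φ (counter (fun s => ξ s ω) t l) ∂μ
      = ∑ n ∈ Finset.range (t + 1), b n * φ n := by
    intro φ
    have hpt : ∀ ω, H (fun s => ξ s ω) * φ (counter (fun s => ξ s ω) t l)
        = ∑ n ∈ Finset.range (t + 1), (H (fun s => ξ s ω) *
            (if counter (fun s => ξ s ω) t l = n then 1 else 0)) * φ n := by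
      intro ω
      rw [Finset.sum_eq_single (counter (fun s => ξ s ω) t l)]
      · simp
      · intro n _ hn
        simp [hn.symm]
      · intro hn
        exact absurd (Finset.mem_range.2 (Nat.lt_succ_of_le (counter_le _ _ _))) hn
    simp_rw [hpt]
    rw [integral_finsetSum]
    · simp_rw [integral_mul_const, hb]
    · exact fun n _ => (hξ.integrable (F := fun z => H z * (if counter z t l = n then 1 else 0))
        (t := t) fun y z h => by simp only [hH h, dependsOn_counter t h]).mul_const _
  have e1 : ∫ ω, H (fun s => ξ s ω) / (counter (fun s => ξ s ω) t l + 1) ∂μ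
      = ∑ n ∈ Finset.range (t + 1), b n * ∫ x in (0 : ℝ)..1, x ^ n := by
    simp only [integral_pow]
    rw [← key fun n : ℕ => ((1 : ℝ) ^ (n + 1) - 0 ^ (n + 1)) / (n + 1)]
    congr 1
    funext ω
    simp [div_eq_mul_inv]
  rw [e1]
  simp_rw [← intervalIntegral.integral_const_mul]
  rw [← intervalIntegral.integral_finsetSum
    fun n _ => (by fun_prop : Continuous fun x : ℝ => b n * x ^ n).intervalIntegrable _ _]
  refine intervalIntegral.integral_mono_on zero_le_one
    ((by fun_prop : Continuous fun x : ℝ => ∑ n ∈ Finset.range (t + 1), b n * x ^ n).intervalIntegrable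
      _ _) (hB.intervalIntegrable _ _) fun x hx => ?_
  rw [← key fun n => x ^ n]
  exact hle x hx.1 hx.2

lemma integral_affine_pow_le {p : ℝ} (hp : 0 < p) (hp1 : p ≤ 1) (t : ℕ) :
    ∫ x in (0 : ℝ)..1, (1 - p + p * x) ^ t ≤ 1 / ((t + 1) * p) := by
  have hder : ∀ x ∈ Set.uIcc (0 : ℝ) 1,
      HasDerivAt (fun x => (1 - p + p * x) ^ (t + 1) / ((t + 1) * p)) ((1 - p + p * x) ^ t) x := by
    intro x _
    have h := ((((hasDerivAt_id x).const_mul p).const_add (1 - p)).pow (t + 1)).div_const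
      ((t + 1) * p)
    refine h.congr_deriv ?_
    have : (t + 1 : ℝ) ≠ 0 := by positivity
    simp only [id, Nat.add_sub_cancel]
    push_cast
    field_simp
  rw [intervalIntegral.integral_eq_sub_of_hasDerivAt hder
    ((by fun_prop : Continuous fun x : ℝ => (1 - p + p * x) ^ t).intervalIntegrable _ _)]
  have : 0 ≤ (1 - p + p * 0) ^ (t + 1) / ((t + 1) * p) :=
    div_nonneg (pow_nonneg (by linarith) _) (by positivity)
  have e : (1 - p + p * 1) = 1 := by ring
  rw [e, one_pow]
  linarith

lemma integral_inv_counter_le (hξ : IIDSamples P.D ξ μ) (l : U ⊕ V) (hl : 0 < P.freq l) (t : ℕ) :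
    ∫ ω, 1 / ((counter (fun s => ξ s ω) t l : ℝ) + 1) ∂μ ≤ 1 / ((t + 1) * P.freq l) := by
  refine (integral_div_counter_add_one_le hξ l t (H := fun _ => 1) (fun _ _ _ => rfl)
    (B := fun x => (1 - P.freq l + P.freq l * x) ^ t) (by fun_prop) fun x _ _ => ?_).trans
    (integral_affine_pow_le hl (P.freq_le_one l) t)
  simp only [one_mul]
  exact (integral_pow_counter hξ l x t).le

lemma integral_counter_div_counter_le (hξ : IIDSamples P.D ξ μ) (k l : U ⊕ V)
    (hk : 0 ≤ P.freq k) (hl : 0 < P.freq l) (t : ℕ) :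
    ∫ ω, (counter (fun s => ξ s ω) t k : ℝ) / ((counter (fun s => ξ s ω) t l : ℝ) + 1) ∂μ
      ≤ P.freq k / P.freq l := by
  rcases t with _ | t
  · simp only [counter, Nat.cast_zero, zero_div, integral_zero]
    positivity
  refine (integral_div_counter_add_one_le hξ l (t + 1) (H := fun z => (counter z (t + 1) k : ℝ))
    (fun y z h => by simp only [dependsOn_counter (t + 1) h])
    (B := fun x => (t + 1) * P.freq k * (1 - P.freq l + P.freq l * x) ^ t) (by fun_prop)
    fun x h0 h1 => ?_).trans ?_
  · simpa using integral_counter_mul_pow_counter_le hξ k l h0 h1 (t + 1)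
  · rw [intervalIntegral.integral_const_mul]
    calc _ ≤ (t + 1) * P.freq k * (1 / ((t + 1) * P.freq l)) :=
          mul_le_mul_of_nonneg_left (integral_affine_pow_le hl (P.freq_le_one l) t) (by positivity)
      _ = _ := by
        have : (t + 1 : ℝ) ≠ 0 := by positivity
        field_simp

lemma sum_pow_one_sub_le {p : ℝ} (hp : 0 < p) (hp1 : p ≤ 1) (n : ℕ) :
    ∑ t ∈ Finset.range n, (1 - p) ^ t ≤ 1 / p := by
  have h := geom_sum_mul (1 - p) n
  rw [le_div_iff₀ hp]
  have : 0 ≤ (1 - p) ^ n := pow_nonneg (by linarith) n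
  linarith

lemma counterRate_nonneg {L α : ℝ} (hL : 0 < L) (hα : 0 ≤ α) (T t c : ℕ) :
    0 ≤ counterRate L α T t c := by
  unfold counterRate
  split_ifs <;> positivity

lemma counterRate_le {L α : ℝ} (T t c : ℕ) : counterRate L α T t c ≤ 1 / (4 * L) := by
  unfold counterRate
  split_ifs
  · exact le_rfl
  · exact min_le_left _ _

/-- The summand with `0 ^ c` is the indicator of `c = 0`, and `1 / c ≤ 2 / (c + 1)` otherwise. -/
lemma counterRate_sq_le {L α : ℝ} (hL : 0 < L) (hα : 0 ≤ α) (T t c : ℕ) :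
    counterRate L α T t c ^ 2
      ≤ 2 * α ^ 2 * t / T * (1 / ((c : ℝ) + 1)) + 1 / (16 * L ^ 2) * 0 ^ c := by
  rcases eq_or_ne c 0 with rfl | hc
  · have e : (1 / (4 * L)) ^ 2 = 1 / (16 * L ^ 2) := by field_simp; norm_num
    have : 0 ≤ 2 * α ^ 2 * t / T := by positivity
    simp only [counterRate, if_true, e, pow_zero, Nat.cast_zero]
    linarith
  · have h0 := counterRate_nonneg hL hα T t c
    have h1 : counterRate L α T t c ≤ α / √((T : ℝ) * ((c : ℝ) / (t : ℝ))) := by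
      rw [counterRate, if_neg hc]
      exact min_le_right _ _
    have hc1 : (1 : ℝ) ≤ c := by exact_mod_cast Nat.one_le_iff_ne_zero.2 hc
    calc counterRate L α T t c ^ 2 ≤ (α / √((T : ℝ) * ((c : ℝ) / (t : ℝ)))) ^ 2 :=
          pow_le_pow_left₀ h0 h1 2
      -- for `t = 0` both sides vanish, by the convention for division by zero
      _ = α ^ 2 * t / T * (1 / c) := by
          rw [div_pow, Real.sq_sqrt (by positivity)]
          simp only [div_eq_mul_inv, mul_inv, inv_inv, one_mul]
          ring
      _ ≤ α ^ 2 * t / T * (2 * (1 / (c + 1))) := by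
          refine mul_le_mul_of_nonneg_left ?_ (by positivity)
          rw [mul_one_div, div_le_div_iff₀ (by linarith) (by linarith)]
          linarith
      _ = _ := by rw [zero_pow hc]; ring

/-- Total second moment of the learning rates of token `l` along the run, also under the weight
`1 + ν c_k`. -/
lemma sum_integral_counterRate_sq_le (hξ : IIDSamples P.D ξ μ) (hp : ∀ k, 0 < P.freq k)
    (k l : U ⊕ V) {L α ν : ℝ} (hL : 0 < L) (hα : 0 ≤ α) {T : ℕ} (hT : 0 < T) (hν0 : 0 ≤ ν)
    (hν : ν * P.freq k * T ≤ 1) :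
    ∑ t ∈ Finset.range (T + 1), ∫ ω, (1 + ν * counter (fun s => ξ s ω) t k) *
        counterRate L α T t (counter (fun s => ξ s ω) t l) ^ 2 ∂μ
      ≤ 4 * α ^ 2 / P.freq l + 1 / (8 * L ^ 2 * P.freq l) := by
  have hpl := hp l
  have hpk := hp k
  have hT' : (0 : ℝ) < T := by exact_mod_cast hT
  have hint : ∀ t, ∫ ω, (1 + ν * counter (fun s => ξ s ω) t k) *
        counterRate L α T t (counter (fun s => ξ s ω) t l) ^ 2 ∂μ
      ≤ 2 * α ^ 2 * t / T * (1 / ((t + 1) * P.freq l) + ν * (P.freq k / P.freq l))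
        + 1 / (16 * L ^ 2) * ((1 - P.freq l) ^ t
          + ν * (t * P.freq k * (1 - P.freq l) ^ (t - 1))) := by
    intro t
    have d1 := hξ.integrable (t := t) (F := fun z => 1 / ((counter z t l : ℝ) + 1))
      fun y z h => by simp only [dependsOn_counter t h]
    have d2 := hξ.integrable (t := t)
      (F := fun z => (counter z t k : ℝ) / ((counter z t l : ℝ) + 1))
      fun y z h => by simp only [dependsOn_counter t h]
    have d3 := hξ.integrable (t := t) (F := fun z => (0 : ℝ) ^ counter z t l)
      fun y z h => by simp only [dependsOn_counter t h]
    have d4 := hξ.integrable (t := t) (F := fun z => (counter z t k : ℝ) * 0 ^ counter z t l)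
      fun y z h => by simp only [dependsOn_counter t h]
    have d12 : Integrable (fun ω => 1 / ((counter (fun s => ξ s ω) t l : ℝ) + 1)
        + ν * ((counter (fun s => ξ s ω) t k : ℝ) / ((counter (fun s => ξ s ω) t l : ℝ) + 1))) μ :=
      d1.add (d2.const_mul ν)
    have d34 : Integrable (fun ω => (0 : ℝ) ^ counter (fun s => ξ s ω) t l
        + ν * ((counter (fun s => ξ s ω) t k : ℝ) * 0 ^ counter (fun s => ξ s ω) t l)) μ :=
      d3.add (d4.const_mul ν)
    calc _ ≤ ∫ ω, (2 * α ^ 2 * t / T * (1 / ((counter (fun s => ξ s ω) t l : ℝ) + 1)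
              + ν * ((counter (fun s => ξ s ω) t k : ℝ)
                / ((counter (fun s => ξ s ω) t l : ℝ) + 1)))
            + 1 / (16 * L ^ 2) * (0 ^ counter (fun s => ξ s ω) t l
              + ν * ((counter (fun s => ξ s ω) t k : ℝ) * 0 ^ counter (fun s => ξ s ω) t l))) ∂μ := by
          refine integral_mono (hξ.integrable (t := t)
            (F := fun z => (1 + ν * counter z t k) * counterRate L α T t (counter z t l) ^ 2)
            fun y z h => by simp only [dependsOn_counter t h])
            ((d12.const_mul _).add (d34.const_mul _))
            fun ω => ?_
          have h1 := mul_le_mul_of_nonneg_left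
            (counterRate_sq_le hL hα T t (counter (fun s => ξ s ω) t l))
            (by positivity : 0 ≤ 1 + ν * (counter (fun s => ξ s ω) t k : ℝ))
          refine h1.trans (le_of_eq ?_)
          ring
      _ = 2 * α ^ 2 * t / T * (∫ ω, 1 / ((counter (fun s => ξ s ω) t l : ℝ) + 1) ∂μ
              + ν * ∫ ω, (counter (fun s => ξ s ω) t k : ℝ)
                / ((counter (fun s => ξ s ω) t l : ℝ) + 1) ∂μ)
            + 1 / (16 * L ^ 2) * (∫ ω, 0 ^ counter (fun s => ξ s ω) t l ∂μ
              + ν * ∫ ω, (counter (fun s => ξ s ω) t k : ℝ) * 0 ^ counter (fun s => ξ s ω) t l ∂μ) := by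
          rw [integral_add (d12.const_mul _) (d34.const_mul _), integral_const_mul,
            integral_const_mul, integral_add d1 (d2.const_mul ν), integral_add d3 (d4.const_mul ν),
            integral_const_mul, integral_const_mul]
      _ ≤ _ := by
          have i1 := integral_inv_counter_le hξ l hpl t
          have i2 := integral_counter_div_counter_le hξ k l hpk.le hpl t
          have i3 := (integral_pow_counter hξ l 0 t).le
          have i4 := integral_counter_mul_pow_counter_le hξ k l le_rfl zero_le_one t
          simp only [mul_zero, add_zero] at i3 i4
          gcongr
  have hA : ∀ t ∈ Finset.range T, 2 * α ^ 2 * ((t + 1 : ℕ) : ℝ) / T *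
      (1 / ((((t + 1 : ℕ) : ℝ) + 1) * P.freq l) + ν * (P.freq k / P.freq l))
      ≤ 4 * α ^ 2 / P.freq l / T := by
    intro t ht
    have ht' : ((t + 1 : ℕ) : ℝ) ≤ T := by exact_mod_cast Finset.mem_range.1 ht
    set s : ℝ := ((t + 1 : ℕ) : ℝ) with hs
    have hs0 : 0 ≤ s := Nat.cast_nonneg _
    have h1 : s * (1 / ((s + 1) * P.freq l)) ≤ 1 / P.freq l := by
      rw [mul_one_div, div_le_div_iff₀ (by positivity) hpl]
      nlinarith
    have h2 : s * (ν * (P.freq k / P.freq l)) ≤ 1 / P.freq l := by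
      rw [show s * (ν * (P.freq k / P.freq l)) = ν * P.freq k * s / P.freq l by ring]
      gcongr
      exact (mul_le_mul_of_nonneg_left ht' (by positivity)).trans hν
    calc _ = 2 * α ^ 2 / T * (s * (1 / ((s + 1) * P.freq l)) + s * (ν * (P.freq k / P.freq l))) := by
          ring
      _ ≤ 2 * α ^ 2 / T * (1 / P.freq l + 1 / P.freq l) := by gcongr
      _ = _ := by ring
  have hB : ∀ t ∈ Finset.range T, ν * (((t + 1 : ℕ) : ℝ) * P.freq k * (1 - P.freq l) ^ t)
      ≤ (1 - P.freq l) ^ t := by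
    intro t ht
    have ht' : ((t + 1 : ℕ) : ℝ) ≤ T := by exact_mod_cast Finset.mem_range.1 ht
    have h1 : ν * P.freq k * ((t + 1 : ℕ) : ℝ) ≤ 1 :=
      (mul_le_mul_of_nonneg_left ht' (by positivity)).trans hν
    have h2 : 0 ≤ (1 - P.freq l) ^ t := pow_nonneg (by linarith [P.freq_le_one l]) t
    calc _ = ν * P.freq k * ((t + 1 : ℕ) : ℝ) * (1 - P.freq l) ^ t := by ring
      _ ≤ _ := mul_le_of_le_one_left h2 h1
  refine (Finset.sum_le_sum fun t _ => hint t).trans ?_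
  rw [Finset.sum_add_distrib, ← Finset.mul_sum _ _ (1 / (16 * L ^ 2)), Finset.sum_add_distrib]
  have s1 : ∑ t ∈ Finset.range (T + 1), 2 * α ^ 2 * (t : ℝ) / T *
      (1 / (((t : ℝ) + 1) * P.freq l) + ν * (P.freq k / P.freq l)) ≤ 4 * α ^ 2 / P.freq l := by
    rw [Finset.sum_range_succ']
    simp only [Nat.cast_zero, mul_zero, zero_div, zero_mul, add_zero]
    refine (Finset.sum_le_sum hA).trans (le_of_eq ?_)
    rw [Finset.sum_const, Finset.card_range, nsmul_eq_mul]
    field_simp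
  have s2 := sum_pow_one_sub_le hpl (P.freq_le_one l) (T + 1)
  have s3 : ∑ t ∈ Finset.range (T + 1), ν * ((t : ℝ) * P.freq k * (1 - P.freq l) ^ (t - 1))
      ≤ 1 / P.freq l := by
    rw [Finset.sum_range_succ']
    simp only [Nat.cast_zero, mul_zero, zero_mul, add_zero, Nat.add_sub_cancel]
    exact (Finset.sum_le_sum hB).trans (sum_pow_one_sub_le hpl (P.freq_le_one l) T)
  refine (add_le_add s1 (mul_le_mul_of_nonneg_left (add_le_add s2 s3) (by positivity))).trans
    (le_of_eq ?_)
  field_simp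
  ring

end Counters

/-! ### Expected descent along the run -/

section Run

variable {U V : Type*} [Fintype U] [Fintype V] {d : ℕ}

lemma dependsOn_cfsgd (P : Problem U V d) (L α : ℝ) (T : ℕ) (Θ₀ : Params U V d) (t : ℕ) :
    DependsOn (fun z : ℕ → U × V => cfsgd P L α T Θ₀ z t) (Set.Iio t) := by
  induction t with
  | zero => intro x y _; rfl
  | succ t ih =>
    intro x y h
    have h1 : cfsgd P L α T Θ₀ x t = cfsgd P L α T Θ₀ y t :=
      ih fun i hi => h i (Nat.lt_succ_of_lt hi)
    have h2 : x t = y t := h t (Nat.lt_succ_self t)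
    have h3 : counter x t = counter y t :=
      dependsOn_counter t fun i hi => h i (Nat.lt_succ_of_lt hi)
    change cfsgd P L α T Θ₀ x (t + 1) = cfsgd P L α T Θ₀ y (t + 1)
    rw [cfsgd, cfsgd, h1, h2, h3]

lemma cfsgd_update_succ (P : Problem U V d) (L α : ℝ) (T : ℕ) (Θ₀ : Params U V d)
    (z : ℕ → U × V) (t : ℕ) (w : U × V) :
    cfsgd P L α T Θ₀ (Function.update z t w) (t + 1)
      = WithLp.toLp 2 fun l => cfsgd P L α T Θ₀ z t l
          - counterRate L α T t (counter z t l) • P.stochGrad (cfsgd P L α T Θ₀ z t) w l := by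
  have h : cfsgd P L α T Θ₀ (Function.update z t w) t = cfsgd P L α T Θ₀ z t :=
    dependsOn_cfsgd P L α T Θ₀ t fun _ hi => Function.update_of_ne (ne_of_lt hi) _ _
  rw [cfsgd, h, counter_update, Function.update_self]

/-- The optimality gap `f(Θ^t) - f*` along the sample path `z`. -/
noncomputable def gap (P : Problem U V d) (L α : ℝ) (T : ℕ) (Θ₀ : Params U V d) (t : ℕ)
    (z : ℕ → U × V) : ℝ :=
  P.obj (cfsgd P L α T Θ₀ z t) - P.optVal

/-- The first-order decrease `∑ l, η̂_l ‖∇f_l(Θ^t)‖²` of the objective along the sample path `z`. -/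
noncomputable def decrease (P : Problem U V d) (L α : ℝ) (T : ℕ) (Θ₀ : Params U V d) (t : ℕ)
    (z : ℕ → U × V) : ℝ :=
  ∑ l, counterRate L α T t (counter z t l) * ‖gradient P.obj (cfsgd P L α T Θ₀ z t) l‖ ^ 2

/-- The noise term `L ∑ l, p_l² σ_l² η̂_l²` of step `t` along the sample path `z`. -/
noncomputable def stepNoise (P : Problem U V d) (L α : ℝ) (σ : U ⊕ V → ℝ) (T t : ℕ)
    (z : ℕ → U × V) : ℝ :=
  L * ∑ l, P.freq l ^ 2 * σ l ^ 2 * counterRate L α T t (counter z t l) ^ 2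

variable {P : Problem U V d} {L α : ℝ} {T : ℕ} {Θ₀ : Params U V d} {σ : U ⊕ V → ℝ} {ν : ℝ}

lemma dependsOn_gap (t : ℕ) : DependsOn (gap P L α T Θ₀ t) (Set.Iio t) :=
  fun x y h => by
    have h1 : cfsgd P L α T Θ₀ x t = cfsgd P L α T Θ₀ y t := dependsOn_cfsgd P L α T Θ₀ t h
    rw [gap, gap, h1]

lemma dependsOn_decrease (t : ℕ) : DependsOn (decrease P L α T Θ₀ t) (Set.Iio t) :=
  fun x y h => by
    have h1 : cfsgd P L α T Θ₀ x t = cfsgd P L α T Θ₀ y t := dependsOn_cfsgd P L α T Θ₀ t h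
    have h2 : counter x t = counter y t := dependsOn_counter t h
    rw [decrease, decrease, h1, h2]

lemma dependsOn_stepNoise (t : ℕ) : DependsOn (stepNoise P L α σ T t) (Set.Iio t) :=
  fun x y h => by
    have h2 : counter x t = counter y t := dependsOn_counter t h
    rw [stepNoise, stepNoise, h2]

lemma dependsOn_sq_norm_gradient (k : U ⊕ V) (t : ℕ) :
    DependsOn (fun z => ‖gradient P.obj (cfsgd P L α T Θ₀ z t) k‖ ^ 2) (Set.Iio t) :=
  fun x y hxy => by
    have h1 : cfsgd P L α T Θ₀ x t = cfsgd P L α T Θ₀ y t := dependsOn_cfsgd P L α T Θ₀ t hxy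
    simp only [h1]

lemma gap_nonneg (hb : BddBelow (Set.range P.obj)) (t : ℕ) (z : ℕ → U × V) :
    0 ≤ gap P L α T Θ₀ t z := sub_nonneg.2 (ciInf_le hb _)

lemma decrease_nonneg (hL : 0 < L) (hα : 0 ≤ α) (t : ℕ) (z : ℕ → U × V) :
    0 ≤ decrease P L α T Θ₀ t z :=
  Finset.sum_nonneg fun _ _ => mul_nonneg (counterRate_nonneg hL hα _ _ _) (sq_nonneg _)

lemma stepNoise_nonneg (hL : 0 < L) (t : ℕ) (z : ℕ → U × V) :
    0 ≤ stepNoise P L α σ T t z :=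
  mul_nonneg hL.le <| Finset.sum_nonneg fun _ _ => by positivity

lemma Problem.Mf_eq (P : Problem U V d) (L : ℝ) (σ : U ⊕ V → ℝ) (Θ₀ : Params U V d) :
    P.Mf L σ Θ₀ = P.obj Θ₀ - P.optVal + P.noise σ / L := by
  rw [Problem.Mf, Problem.noise, Finset.sum_div]

lemma Problem.noise_nonneg (P : Problem U V d) (hp : ∀ k, 0 < P.freq k) (σ : U ⊕ V → ℝ) :
    0 ≤ P.noise σ :=
  Finset.sum_nonneg fun l _ => mul_nonneg (hp l).le (sq_nonneg _)

variable [MeasurableSpace U] [DiscreteMeasurableSpace U] [MeasurableSpace V]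
  [DiscreteMeasurableSpace V] {Ω : Type*} [MeasurableSpace Ω] {μ : Measure Ω}
  [IsProbabilityMeasure μ] {ξ : ℕ → Ω → U × V}

/-- Expected one-step change of the weighted optimality gap. -/
lemma integral_weight_mul_gap_succ_le (hξ : IIDSamples P.D ξ μ) (h : P.SmoothLoss L) (hL : 0 < L)
    (hα : 0 ≤ α) (hp : ∀ k, 0 < P.freq k) (hν0 : 0 ≤ ν) (hν : ν ≤ 1 / 5) (k : U ⊕ V) {t : ℕ}
    (hv : ∀ᵐ ω ∂μ, P.CondVarianceLE σ (cfsgd P L α T Θ₀ (fun s => ξ s ω) t)) :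
    ∫ ω, weight ν k (t + 1) (fun s => ξ s ω) * gap P L α T Θ₀ (t + 1) (fun s => ξ s ω) ∂μ
        + 1 / 2 * ∫ ω, weight ν k t (fun s => ξ s ω) * decrease P L α T Θ₀ t (fun s => ξ s ω) ∂μ
      ≤ ∫ ω, weight ν k t (fun s => ξ s ω) * gap P L α T Θ₀ t (fun s => ξ s ω) ∂μ
        + ν * P.freq k * ∫ ω, gap P L α T Θ₀ t (fun s => ξ s ω) ∂μ
        + 2 * ∫ ω, weight ν k t (fun s => ξ s ω) * stepNoise P L α σ T t (fun s => ξ s ω) ∂μ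
        + ν * P.freq k * (P.noise σ / (8 * L)) := by
  have hdep : DependsOn (fun z : ℕ → U × V => weight ν k (t + 1) z * gap P L α T Θ₀ (t + 1) z)
      (Set.Iio (t + 1)) := (dependsOn_weight k (t + 1)).fun_mul (dependsOn_gap (t + 1))
  have i1 := hξ.integrable ((dependsOn_weight (ν := ν) k t).fun_mul
    (dependsOn_gap (P := P) (L := L) (α := α) (T := T) (Θ₀ := Θ₀) t))
  have i2 := hξ.integrable (dependsOn_gap (P := P) (L := L) (α := α) (T := T) (Θ₀ := Θ₀) t)
  have i3 := hξ.integrable ((dependsOn_weight (ν := ν) k t).fun_mul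
    (dependsOn_decrease (P := P) (L := L) (α := α) (T := T) (Θ₀ := Θ₀) t))
  have i4 := hξ.integrable ((dependsOn_weight (ν := ν) k t).fun_mul
    (dependsOn_stepNoise (P := P) (L := L) (α := α) (σ := σ) (T := T) t))
  have j2 : Integrable (fun ω => weight ν k t (fun s => ξ s ω) * gap P L α T Θ₀ t (fun s => ξ s ω)
      + ν * P.freq k * gap P L α T Θ₀ t (fun s => ξ s ω)) μ := i1.add (i2.const_mul _)
  have j3 : Integrable (fun ω => weight ν k t (fun s => ξ s ω) * gap P L α T Θ₀ t (fun s => ξ s ω)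
      + ν * P.freq k * gap P L α T Θ₀ t (fun s => ξ s ω)
      - 1 / 2 * (weight ν k t (fun s => ξ s ω) * decrease P L α T Θ₀ t (fun s => ξ s ω))) μ :=
    j2.sub (i3.const_mul _)
  have j4 : Integrable (fun ω => weight ν k t (fun s => ξ s ω) * gap P L α T Θ₀ t (fun s => ξ s ω)
      + ν * P.freq k * gap P L α T Θ₀ t (fun s => ξ s ω)
      - 1 / 2 * (weight ν k t (fun s => ξ s ω) * decrease P L α T Θ₀ t (fun s => ξ s ω))
      + 2 * (weight ν k t (fun s => ξ s ω) * stepNoise P L α σ T t (fun s => ξ s ω))) μ :=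
    j3.add (i4.const_mul _)
  rw [hξ.integral_eq_integral_update hdep]
  have hle : ∫ ω, ∑ w, (P.D w).toReal *
        (weight ν k (t + 1) (Function.update (fun s => ξ s ω) t w)
          * gap P L α T Θ₀ (t + 1) (Function.update (fun s => ξ s ω) t w)) ∂μ
      ≤ ∫ ω, (weight ν k t (fun s => ξ s ω) * gap P L α T Θ₀ t (fun s => ξ s ω)
          + ν * P.freq k * gap P L α T Θ₀ t (fun s => ξ s ω)
          - 1 / 2 * (weight ν k t (fun s => ξ s ω) * decrease P L α T Θ₀ t (fun s => ξ s ω))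
          + 2 * (weight ν k t (fun s => ξ s ω) * stepNoise P L α σ T t (fun s => ξ s ω))
          + ν * P.freq k * (P.noise σ / (8 * L))) ∂μ := by
    refine integral_mono_ae (hξ.integrable (t := t) (F := fun z => ∑ w, (P.D w).toReal *
        (weight ν k (t + 1) (Function.update z t w)
          * gap P L α T Θ₀ (t + 1) (Function.update z t w))) fun y z hyz => ?_)
      (j4.add (integrable_const _)) ?_
    · exact Finset.sum_congr rfl fun w _ => congrArg _ (dependsOn_update hdep w hyz)
    · filter_upwards [hv] with ω hω
      have key := Problem.weighted_descent h hL hω hp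
        (η := fun l => counterRate L α T t (counter (fun s => ξ s ω) t l))
        (fun l => counterRate_nonneg hL hα _ _ _) (fun l => counterRate_le _ _ _) hν0 hν
        (Nat.cast_nonneg (counter (fun s => ξ s ω) t k)) k
      refine le_trans (le_of_eq ?_) key
      refine Finset.sum_congr rfl fun w _ => ?_
      rw [weight, gap, cfsgd_update_succ, counter_update_succ]
      rfl
  rw [integral_add j4 (integrable_const _), integral_add j3 (i4.const_mul _),
    integral_sub j2 (i3.const_mul _), integral_add i1 (i2.const_mul _), integral_const_mul,
    integral_const_mul, integral_const_mul, integral_const] at hle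
  simp only [probReal_univ, one_smul] at hle
  linarith

lemma integral_weight_mul_gap_add_sum_le (hξ : IIDSamples P.D ξ μ) (h : P.SmoothLoss L)
    (hL : 0 < L) (hα : 0 ≤ α) (hp : ∀ k, 0 < P.freq k) (hν0 : 0 ≤ ν) (hν : ν ≤ 1 / 5) (k : U ⊕ V)
    (hv : ∀ t ≤ T, ∀ᵐ ω ∂μ, P.CondVarianceLE σ (cfsgd P L α T Θ₀ (fun s => ξ s ω) t))
    (n : ℕ) (hn : n ≤ T + 1) :
    ∫ ω, weight ν k n (fun s => ξ s ω) * gap P L α T Θ₀ n (fun s => ξ s ω) ∂μ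
        + 1 / 2 * ∑ t ∈ Finset.range n,
          ∫ ω, weight ν k t (fun s => ξ s ω) * decrease P L α T Θ₀ t (fun s => ξ s ω) ∂μ
      ≤ P.obj Θ₀ - P.optVal
        + ν * P.freq k * ∑ t ∈ Finset.range n, ∫ ω, gap P L α T Θ₀ t (fun s => ξ s ω) ∂μ
        + 2 * ∑ t ∈ Finset.range n,
          ∫ ω, weight ν k t (fun s => ξ s ω) * stepNoise P L α σ T t (fun s => ξ s ω) ∂μ
        + n * (ν * P.freq k * (P.noise σ / (8 * L))) := by
  induction n with
  | zero => simp [weight, gap, counter, cfsgd]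
  | succ n ih =>
    have h1 := ih (by omega)
    have h2 := integral_weight_mul_gap_succ_le hξ h hL hα hp hν0 hν k (hv n (by omega))
    simp only [Finset.sum_range_succ]
    push_cast
    linarith

/-- Total noise of the run: the tokens sampled before contribute at most
`4 L α² ∑ p_l σ_l²`, those not sampled so far the rest. -/
lemma sum_integral_weight_mul_stepNoise_le (hξ : IIDSamples P.D ξ μ) (hL : 0 < L)
    (hα : 0 ≤ α) (hp : ∀ k, 0 < P.freq k) (hT : 0 < T) (hν0 : 0 ≤ ν) (k : U ⊕ V)
    (hν : ν * P.freq k * T ≤ 1) {n : ℕ} (hn : n ≤ T + 1) :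
    ∑ t ∈ Finset.range n,
        ∫ ω, weight ν k t (fun s => ξ s ω) * stepNoise P L α σ T t (fun s => ξ s ω) ∂μ
      ≤ 4 * (L * α ^ 2 * P.noise σ) + P.noise σ / (8 * L) := by
  have hfull : ∑ t ∈ Finset.range n,
        ∫ ω, weight ν k t (fun s => ξ s ω) * stepNoise P L α σ T t (fun s => ξ s ω) ∂μ
      ≤ ∑ t ∈ Finset.range (T + 1),
        ∫ ω, weight ν k t (fun s => ξ s ω) * stepNoise P L α σ T t (fun s => ξ s ω) ∂μ :=
    Finset.sum_le_sum_of_subset_of_nonneg (Finset.range_mono hn) fun t _ _ =>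
      integral_nonneg fun ω => mul_nonneg (zero_le_one.trans (one_le_weight hν0 k t _))
        (stepNoise_nonneg hL t _)
  have e : ∀ t, ∫ ω, weight ν k t (fun s => ξ s ω) * stepNoise P L α σ T t (fun s => ξ s ω) ∂μ
      = ∑ l, L * (P.freq l ^ 2 * σ l ^ 2) * ∫ ω, (1 + ν * counter (fun s => ξ s ω) t k) *
          counterRate L α T t (counter (fun s => ξ s ω) t l) ^ 2 ∂μ := by
    intro t
    simp_rw [← integral_const_mul]
    rw [← integral_finsetSum]
    · congr 1
      funext ω
      rw [weight, stepNoise, Finset.mul_sum, Finset.mul_sum]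
      exact Finset.sum_congr rfl fun l _ => by ring
    · exact fun l _ => (hξ.integrable (t := t) (F := fun z => (1 + ν * counter z t k) *
        counterRate L α T t (counter z t l) ^ 2) fun y z hyz => by
          simp only [dependsOn_counter t hyz]).const_mul _
  refine hfull.trans ?_
  simp_rw [e]
  rw [Finset.sum_comm]
  simp_rw [← Finset.mul_sum]
  calc _ ≤ ∑ l, L * (P.freq l ^ 2 * σ l ^ 2) *
          (4 * α ^ 2 / P.freq l + 1 / (8 * L ^ 2 * P.freq l)) :=
        Finset.sum_le_sum fun l _ => mul_le_mul_of_nonneg_left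
          (sum_integral_counterRate_sq_le hξ hp k l hL hα hT hν0 hν) (by positivity)
    _ = _ := by
        rw [Problem.noise, Finset.mul_sum, Finset.mul_sum, Finset.sum_div,
          ← Finset.sum_add_distrib]
        refine Finset.sum_congr rfl fun l _ => ?_
        have := (hp l).ne'
        field_simp

/-- With `α = √(M_f / (L ∑ p_l σ_l²))` the expected optimality gap stays of order `M_f`. -/
lemma integral_gap_le (hξ : IIDSamples P.D ξ μ) (h : P.SmoothLoss L) (hL : 0 < L) (hα : 0 ≤ α)
    (hαM : L * α ^ 2 * P.noise σ = P.Mf L σ Θ₀) (hb : BddBelow (Set.range P.obj))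
    (hp : ∀ k, 0 < P.freq k) (hT : 0 < T) (k : U ⊕ V)
    (hv : ∀ t ≤ T, ∀ᵐ ω ∂μ, P.CondVarianceLE σ (cfsgd P L α T Θ₀ (fun s => ξ s ω) t))
    {n : ℕ} (hn : n ≤ T + 1) :
    ∫ ω, gap P L α T Θ₀ n (fun s => ξ s ω) ∂μ ≤ 9 * P.Mf L σ Θ₀ := by
  have h1 := integral_weight_mul_gap_add_sum_le (ν := 0) hξ h hL hα hp le_rfl (by norm_num) k hv n
    hn
  have h2 := sum_integral_weight_mul_stepNoise_le (σ := σ) (ν := 0) hξ hL hα hp hT le_rfl k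
    (by simp) hn
  simp only [weight, zero_mul, add_zero, one_mul, mul_zero] at h1 h2
  have h3 : 0 ≤ ∑ t ∈ Finset.range n, ∫ ω, decrease P L α T Θ₀ t (fun s => ξ s ω) ∂μ :=
    Finset.sum_nonneg fun t _ => integral_nonneg fun ω => decrease_nonneg hL hα t _
  have h4 := P.Mf_eq L σ Θ₀
  have h5 : 0 ≤ P.obj Θ₀ - P.optVal := sub_nonneg.2 (ciInf_le hb _)
  have h6 : P.noise σ / (8 * L) = P.noise σ / L / 8 := by field_simp
  have hN : 0 ≤ P.noise σ / L := div_nonneg (P.noise_nonneg hp σ) hL.le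
  rw [hαM, h6] at h2
  linarith

/-- The case `ν = 0` bounds the expected gaps that appear on the right of the weighted descent. -/
lemma sum_integral_weight_mul_decrease_le (hξ : IIDSamples P.D ξ μ) (h : P.SmoothLoss L)
    (hL : 0 < L) (hα : 0 ≤ α) (hαM : L * α ^ 2 * P.noise σ = P.Mf L σ Θ₀)
    (hb : BddBelow (Set.range P.obj)) (hp : ∀ k, 0 < P.freq k) (hT : 0 < T) (k : U ⊕ V)
    (hv : ∀ t ≤ T, ∀ᵐ ω ∂μ, P.CondVarianceLE σ (cfsgd P L α T Θ₀ (fun s => ξ s ω) t))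
    (hν0 : 0 ≤ ν) (hν : ν ≤ 1 / 5) (hνT : ν * P.freq k * T ≤ 1) :
    ∑ t ∈ Finset.range (T + 1),
        ∫ ω, weight ν k t (fun s => ξ s ω) * decrease P L α T Θ₀ t (fun s => ξ s ω) ∂μ
      ≤ 54 * P.Mf L σ Θ₀ := by
  have h1 := integral_weight_mul_gap_add_sum_le hξ h hL hα hp hν0 hν k hv (T + 1) le_rfl
  have h2 := sum_integral_weight_mul_stepNoise_le (σ := σ) hξ hL hα hp hT hν0 k hνT
    (le_refl (T + 1))
  have h3 : 0 ≤ ∫ ω, weight ν k (T + 1) (fun s => ξ s ω)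
      * gap P L α T Θ₀ (T + 1) (fun s => ξ s ω) ∂μ :=
    integral_nonneg fun ω => mul_nonneg (zero_le_one.trans (one_le_weight hν0 k _ _))
      (gap_nonneg hb _ _)
  have h4 := P.Mf_eq L σ Θ₀
  have h5 : 0 ≤ P.obj Θ₀ - P.optVal := sub_nonneg.2 (ciInf_le hb _)
  have h6 : P.noise σ / (8 * L) = P.noise σ / L / 8 := by field_simp
  have hN : 0 ≤ P.noise σ / L := div_nonneg (P.noise_nonneg hp σ) hL.le
  have hM : 0 ≤ P.Mf L σ Θ₀ := by rw [h4]; exact add_nonneg h5 hN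
  have h7 : ∑ t ∈ Finset.range (T + 1), ∫ ω, gap P L α T Θ₀ t (fun s => ξ s ω) ∂μ
      ≤ (T + 1) * (9 * P.Mf L σ Θ₀) := by
    refine (Finset.sum_le_sum fun t ht => integral_gap_le hξ h hL hα hαM hb hp hT k hv
      (Finset.mem_range.1 ht).le).trans (le_of_eq ?_)
    rw [Finset.sum_const, Finset.card_range, nsmul_eq_mul]
    push_cast
    ring
  have hT1 : (1 : ℝ) ≤ T := by exact_mod_cast hT
  have hνp : 0 ≤ ν * P.freq k := mul_nonneg hν0 (hp k).le
  have h8 : ν * P.freq k * (T + 1) ≤ 2 := by nlinarith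
  have h9 := mul_le_mul_of_nonneg_left h7 hνp
  have h10 := mul_le_mul_of_nonneg_right h8 (by linarith : 0 ≤ 9 * P.Mf L σ Θ₀)
  have h11 := mul_le_mul_of_nonneg_right h8 (by linarith : 0 ≤ P.noise σ / L / 8)
  rw [hαM, h6] at h2
  rw [h6] at h1
  push_cast at h1
  linarith

end Run

/-! ### From the descent to the gradient at the output index -/

/-- The learning rate of a token of frequency `p` is not too small compared with the weight
`1 + c / (p T)`, however large the counter `c` is. -/
lemma one_le_mul_counterRate {L α p : ℝ} (hL : 0 < L) (hα : 0 < α) (hp : 0 < p) {T t : ℕ}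
    (c : ℕ) (hT : 0 < T) (ht : T ≤ 2 * t) :
    1 ≤ (4 * L + √(2 * p * T) / α) *
      ((1 + 1 / (p * T) * c) * counterRate L α T t c) := by
  have hT' : (0 : ℝ) < T := by exact_mod_cast hT
  have ht' : (T : ℝ) ≤ 2 * t := by exact_mod_cast ht
  have ht0 : (0 : ℝ) < t := by linarith
  have hW : 1 ≤ 1 + 1 / (p * T) * (c : ℝ) := by
    have : 0 ≤ 1 / (p * T) * (c : ℝ) := by positivity
    linarith
  set W := 1 + 1 / (p * T) * (c : ℝ) with hWd
  have hq : 0 ≤ √(2 * p * T) / α := by positivity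
  have ha : 1 ≤ (4 * L + √(2 * p * T) / α) * (W * (1 / (4 * L))) := by
    calc (1 : ℝ) = (4 * L) * (1 * (1 / (4 * L))) := by field_simp
      _ ≤ _ := by gcongr; linarith
  unfold counterRate
  split_ifs with hc
  · exact ha
  · rcases min_choice (1 / (4 * L)) (α / √((T : ℝ) * ((c : ℝ) / (t : ℝ)))) with hm | hm
    · rw [hm]; exact ha
    · rw [hm]
      have hc0 : (0 : ℝ) < c := by exact_mod_cast Nat.pos_of_ne_zero hc
      have hpos : 0 < √((T : ℝ) * ((c : ℝ) / (t : ℝ))) := Real.sqrt_pos.2 (by positivity)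
      have hs : √((T : ℝ) * ((c : ℝ) / (t : ℝ))) ≤ √(2 * p * T) * W := by
        refine Real.sqrt_le_iff.2 ⟨by positivity, ?_⟩
        rw [mul_pow, Real.sq_sqrt (by positivity)]
        have e1 : (T : ℝ) * ((c : ℝ) / t) ≤ 2 * c := by
          rw [← mul_div_assoc, div_le_iff₀ ht0]
          nlinarith
        have e2 : 2 * (c : ℝ) ≤ 2 * p * T * W := by
          have : 2 * p * T * W = 2 * p * T + 2 * c := by rw [hWd]; field_simp
          rw [this]
          have : 0 < 2 * p * T := by positivity
          linarith
        have e3 : 2 * p * T * W ≤ 2 * p * T * W ^ 2 := by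
          have : 0 < 2 * p * T := by positivity
          gcongr
          nlinarith
        linarith
      calc (1 : ℝ) ≤ √(2 * p * T) * W / √((T : ℝ) * ((c : ℝ) / (t : ℝ))) := by
            rwa [le_div_iff₀ hpos, one_mul]
        _ = √(2 * p * T) / α * (W * (α / √((T : ℝ) * ((c : ℝ) / (t : ℝ))))) := by
            field_simp
        _ ≤ _ := by gcongr; linarith

section Output

variable {α Ω : Type*} [Fintype α] [MeasurableSpace α] [MeasurableSingletonClass α]
  [MeasurableSpace Ω] {μ : Measure Ω} [IsProbabilityMeasure μ] {ξ : ℕ → Ω → α} {D : PMF α}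

/-- The output index is independent of the samples, so the expectation at the output is the average
of the expectations at the times `T / 2 ≤ t ≤ T`. -/
lemma integral_output_eq (hξ : IIDSamples D ξ μ) {τ : Ω → ℕ} {T : ℕ} (hτ : Measurable τ)
    (hτT : μ.map τ = (outputLaw T).toMeasure) (hind : IndepFun τ (fun ω t => ξ t ω) μ)
    {Φ : ℕ → (ℕ → α) → ℝ} (hΦ : ∀ t, DependsOn (Φ t) (Set.Iio t)) :
    Integrable (fun ω => Φ (τ ω) fun s => ξ s ω) μ ∧
      ∫ ω, Φ (τ ω) (fun s => ξ s ω) ∂μ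
        = ((Finset.Icc ((T + 1) / 2) T).card : ℝ)⁻¹ *
          ∑ t ∈ Finset.Icc ((T + 1) / 2) T, ∫ ω, Φ t (fun s => ξ s ω) ∂μ := by
  classical
  set I := Finset.Icc ((T + 1) / 2) T with hI
  have hlaw : ∀ t, μ.map τ {t} = outputLaw T t := fun t => by
    rw [hτT, PMF.toMeasure_apply_singleton _ _ (measurableSet_singleton t)]
  have hmem : ∀ᵐ ω ∂μ, τ ω ∈ I := by
    have h1 : ∀ᵐ n ∂(μ.map τ), n ∈ I := by
      rw [hτT, ae_iff, PMF.toMeasure_apply_eq_zero_iff _ (MeasurableSet.of_discrete)]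
      rw [Set.disjoint_left]
      intro n hn hn'
      rw [outputLaw, PMF.support_uniformOfFinset] at hn
      exact hn' hn
    exact ae_of_ae_map hτ.aemeasurable h1
  have hpt : (fun ω => Φ (τ ω) fun s => ξ s ω) =ᵐ[μ] fun ω => ∑ t ∈ I,
      Set.indicator {t} (fun _ => (1 : ℝ)) (τ ω) * Φ t (fun s => ξ s ω) := by
    filter_upwards [hmem] with ω hω
    rw [Finset.sum_eq_single (τ ω)]
    · simp
    · intro t _ ht
      simp [Set.indicator, ht.symm]
    · exact fun h => absurd hω h
  have hindm : ∀ t : ℕ, Measurable (Set.indicator {t} fun _ : ℕ => (1 : ℝ)) := fun t =>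
    measurable_const.indicator (measurableSet_singleton t)
  have hterm_int : ∀ t ∈ I, Integrable (fun ω =>
      Set.indicator {t} (fun _ => (1 : ℝ)) (τ ω) * Φ t (fun s => ξ s ω)) μ := by
    intro t _
    refine (hξ.integrable (hΦ t)).bdd_mul (c := 1)
      ((hindm t).comp hτ).aestronglyMeasurable (Filter.Eventually.of_forall fun ω => ?_)
    by_cases h : τ ω = t <;> simp [Set.indicator, h]
  have hterm : ∀ t ∈ I, ∫ ω, Set.indicator {t} (fun _ => (1 : ℝ)) (τ ω) *
      Φ t (fun s => ξ s ω) ∂μ = (I.card : ℝ)⁻¹ * ∫ ω, Φ t (fun s => ξ s ω) ∂μ := by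
    intro t ht
    have h1 := (hind.comp (hindm t) (measurable_of_dependsOn (hΦ t))).integral_fun_mul_eq_mul_integral
      ((hindm t).comp hτ).aestronglyMeasurable
      ((measurable_of_dependsOn (hΦ t)).comp hξ.measurable_path).aestronglyMeasurable
    have h2 : ∫ ω, Set.indicator {t} (fun _ => (1 : ℝ)) (τ ω) ∂μ = (I.card : ℝ)⁻¹ := by
      rw [← integral_map (φ := τ) hτ.aemeasurable (hindm t).aestronglyMeasurable,
        integral_indicator_const _ (measurableSet_singleton t), smul_eq_mul, mul_one,
        Measure.real, hlaw, outputLaw, PMF.uniformOfFinset_apply_of_mem _ ht,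
        ENNReal.toReal_inv, ENNReal.toReal_natCast]
    rw [← h2]
    exact h1
  refine ⟨(integrable_congr hpt).2 (integrable_finsetSum _ hterm_int), ?_⟩
  rw [integral_congr_ae hpt, integral_finsetSum _ hterm_int, Finset.mul_sum]
  exact Finset.sum_congr rfl hterm

end Output

section Bounds

variable {U V : Type*} [Fintype U] [Fintype V] {d : ℕ} {P : Problem U V d} {L α : ℝ} {T : ℕ}
  {Θ₀ : Params U V d} {σ : U ⊕ V → ℝ} [MeasurableSpace U] [DiscreteMeasurableSpace U]
  [MeasurableSpace V] [DiscreteMeasurableSpace V] {Ω : Type*} [MeasurableSpace Ω] {μ : Measure Ω}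
  [IsProbabilityMeasure μ] {ξ : ℕ → Ω → U × V}

/-- Gradient bound from the optimality gap alone; it suffices for a token that is expected to be
sampled only boundedly many times. -/
lemma integral_sq_norm_gradient_le (hξ : IIDSamples P.D ξ μ) (h : P.SmoothLoss L)
    (hL : 0 < L) (hα : 0 ≤ α) (hαM : L * α ^ 2 * P.noise σ = P.Mf L σ Θ₀)
    (hb : BddBelow (Set.range P.obj)) (hp : ∀ k, 0 < P.freq k) (hT : 0 < T) (k : U ⊕ V)
    (hv : ∀ t ≤ T, ∀ᵐ ω ∂μ, P.CondVarianceLE σ (cfsgd P L α T Θ₀ (fun s => ξ s ω) t))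
    {t : ℕ} (ht : t ≤ T + 1) :
    ∫ ω, ‖gradient P.obj (cfsgd P L α T Θ₀ (fun s => ξ s ω) t) k‖ ^ 2 ∂μ
      ≤ 36 * (L * P.freq k * P.Mf L σ Θ₀) := by
  have hpk := hp k
  calc _ ≤ ∫ ω, 4 * L * P.freq k * gap P L α T Θ₀ t (fun s => ξ s ω) ∂μ :=
        integral_mono (hξ.integrable (dependsOn_sq_norm_gradient k t))
          ((hξ.integrable (dependsOn_gap t)).const_mul _)
          fun ω => Problem.sq_norm_gradient_le h hL hb k hpk _
    _ = 4 * L * P.freq k * ∫ ω, gap P L α T Θ₀ t (fun s => ξ s ω) ∂μ := integral_const_mul _ _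
    _ ≤ 4 * L * P.freq k * (9 * P.Mf L σ Θ₀) :=
        mul_le_mul_of_nonneg_left (integral_gap_le hξ h hL hα hαM hb hp hT k hv ht)
          (by positivity)
    _ = _ := by ring

/-- Gradient bound from the weighted descent with `ν = 1 / (p_k T)`. -/
lemma sum_integral_sq_norm_gradient_le (hξ : IIDSamples P.D ξ μ) (h : P.SmoothLoss L)
    (hL : 0 < L) (hα : 0 < α) (hαM : L * α ^ 2 * P.noise σ = P.Mf L σ Θ₀)
    (hb : BddBelow (Set.range P.obj)) (hp : ∀ k, 0 < P.freq k) (hT : 0 < T) (k : U ⊕ V)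
    (hv : ∀ t ≤ T, ∀ᵐ ω ∂μ, P.CondVarianceLE σ (cfsgd P L α T Θ₀ (fun s => ξ s ω) t))
    (hlarge : 5 ≤ P.freq k * T) :
    ∑ t ∈ Finset.Icc ((T + 1) / 2) T,
        ∫ ω, ‖gradient P.obj (cfsgd P L α T Θ₀ (fun s => ξ s ω) t) k‖ ^ 2 ∂μ
      ≤ (4 * L + √(2 * P.freq k * T) / α) * (54 * P.Mf L σ Θ₀) := by
  have hpk := hp k
  have hT' : (0 : ℝ) < T := by exact_mod_cast hT
  set ν := 1 / (P.freq k * T) with hν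
  have hν0 : 0 ≤ ν := by positivity
  have hν5 : ν ≤ 1 / 5 := one_div_le_one_div_of_le (by norm_num) hlarge
  have hνT : ν * P.freq k * T ≤ 1 := by
    rw [hν]
    exact le_of_eq (by field_simp)
  set K := 4 * L + √(2 * P.freq k * T) / α with hK
  have hK0 : 0 ≤ K := by positivity
  have hpt : ∀ t ∈ Finset.Icc ((T + 1) / 2) T,
      ∫ ω, ‖gradient P.obj (cfsgd P L α T Θ₀ (fun s => ξ s ω) t) k‖ ^ 2 ∂μ
        ≤ K * ∫ ω, weight ν k t (fun s => ξ s ω) * decrease P L α T Θ₀ t (fun s => ξ s ω) ∂μ := by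
    intro t ht
    have ht2 : T ≤ 2 * t := by
      have := (Finset.mem_Icc.1 ht).1
      omega
    rw [← integral_const_mul]
    refine integral_mono (hξ.integrable (dependsOn_sq_norm_gradient k t))
      ((hξ.integrable ((dependsOn_weight k t).fun_mul (dependsOn_decrease t))).const_mul _)
      fun ω => ?_
    set z : ℕ → U × V := fun s => ξ s ω
    have h1 := one_le_mul_counterRate hL hα hpk (counter z t k) hT ht2
    have h2 : counterRate L α T t (counter z t k)
        * ‖gradient P.obj (cfsgd P L α T Θ₀ z t) k‖ ^ 2 ≤ decrease P L α T Θ₀ t z :=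
      Finset.single_le_sum (f := fun l => counterRate L α T t (counter z t l)
        * ‖gradient P.obj (cfsgd P L α T Θ₀ z t) l‖ ^ 2)
        (fun l _ => mul_nonneg (counterRate_nonneg hL hα.le _ _ _) (sq_nonneg _))
        (Finset.mem_univ k)
    have hw : 0 ≤ weight ν k t z := zero_le_one.trans (one_le_weight hν0 k t z)
    calc ‖gradient P.obj (cfsgd P L α T Θ₀ z t) k‖ ^ 2
        ≤ K * (weight ν k t z * counterRate L α T t (counter z t k))
          * ‖gradient P.obj (cfsgd P L α T Θ₀ z t) k‖ ^ 2 :=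
          le_mul_of_one_le_left (sq_nonneg _) h1
      _ = K * (weight ν k t z * (counterRate L α T t (counter z t k)
          * ‖gradient P.obj (cfsgd P L α T Θ₀ z t) k‖ ^ 2)) := by ring
      _ ≤ K * (weight ν k t z * decrease P L α T Θ₀ t z) :=
          mul_le_mul_of_nonneg_left (mul_le_mul_of_nonneg_left h2 hw) hK0
  refine (Finset.sum_le_sum hpt).trans ?_
  rw [← Finset.mul_sum]
  refine mul_le_mul_of_nonneg_left ?_ hK0
  refine le_trans ?_ (sum_integral_weight_mul_decrease_le hξ h hL hα.le hαM hb hp hT k hv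
    hν0 hν5 hνT)
  refine Finset.sum_le_sum_of_subset_of_nonneg (fun t ht => ?_) fun t _ _ =>
    integral_nonneg fun ω => mul_nonneg (zero_le_one.trans (one_le_weight hν0 k t _))
      (decrease_nonneg hL hα.le t _)
  exact Finset.mem_range.2 (Nat.lt_succ_of_le (Finset.mem_Icc.1 ht).2)

end Bounds

/-- Substituting `α = √(M / (L S))` with `M = Δ + S / L`, so that `M / α = √(L S Δ + S²)`. -/
lemma rate_le {L M Δ S p T α : ℝ} (hL : 0 < L) (hS : 0 < S) (hΔ : 0 ≤ Δ) (hp : 0 < p) (hT : 0 < T)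
    (hα : 0 < α) (hM : M = Δ + S / L) (hαM : L * α ^ 2 * S = M) :
    (T / 2)⁻¹ * ((4 * L + √(2 * p * T) / α) * (54 * M))
      ≤ 500 * (L * M / T + √p * √(S * L * Δ) / √T + √p * S / √T) := by
  have hMpos : 0 < M := by rw [← hαM]; positivity
  have hroot : M / α ≤ √(S * L * Δ) + S := by
    refine (le_abs_self _).trans (abs_le_of_sq_le_sq ?_ (by positivity))
    have e1 : (M / α) ^ 2 = S * L * Δ + S ^ 2 := by
      calc (M / α) ^ 2 = M * ((L * α ^ 2 * S) / α ^ 2) := by rw [hαM]; ring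
        _ = M * (L * S) := by field_simp
        _ = _ := by rw [hM]; field_simp
    rw [e1, add_sq, Real.sq_sqrt (by positivity)]
    have : 0 ≤ 2 * √(S * L * Δ) * S := by positivity
    linarith
  have hsqrtT : √(2 * p * T) / T = √2 * (√p / √T) := by
    rw [Real.sqrt_mul (by positivity), Real.sqrt_mul (by norm_num), mul_div_assoc,
      Real.sqrt_div_self]
    ring
  have hsqrt2 : √2 ≤ 3 / 2 := Real.sqrt_le_iff.2 ⟨by norm_num, by norm_num⟩
  have h1 : √2 * (√p / √T) * (M / α) ≤ 3 / 2 * (√p / √T) * (√(S * L * Δ) + S) :=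
    mul_le_mul (mul_le_mul_of_nonneg_right hsqrt2 (by positivity)) hroot (by positivity)
      (by positivity)
  have h2 : (T / 2)⁻¹ * ((4 * L + √(2 * p * T) / α) * (54 * M))
      = 432 * (L * M / T) + 108 * (√(2 * p * T) / T * (M / α)) := by
    field_simp
    ring
  rw [h2, hsqrtT]
  have h3 : 0 ≤ L * M / T := by positivity
  have h4 : 0 ≤ √p * √(S * L * Δ) / √T := by positivity
  have h5 : 0 ≤ √p * S / √T := by positivity
  have h6 : 3 / 2 * (√p / √T) * (√(S * L * Δ) + S)
      = 3 / 2 * (√p * √(S * L * Δ) / √T + √p * S / √T) := by ring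
  linarith

end FreqSGD

theorem theorem3 :
    ∃ C : ℝ, 0 < C ∧
      ∀ (U V : Type*) [Fintype U] [Fintype V]
        [MeasurableSpace U] [DiscreteMeasurableSpace U]
        [MeasurableSpace V] [DiscreteMeasurableSpace V]
        (d : ℕ) (P : Problem U V d) (L G : ℝ) (σ : U ⊕ V → ℝ) (Θ₀ : Params U V d) (T : ℕ)
        (Ω : Type*) [MeasurableSpace Ω] (μ : Measure Ω) [IsProbabilityMeasure μ]
        (ξ : ℕ → Ω → U × V) (τ : Ω → ℕ),
        -- the problem: every token occurs, and the infimum of the objective is finite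
        (∀ k, 0 < P.freq k) →
        BddBelow (Set.range P.obj) →
        -- the smoothness assumption and the gradient bound
        0 < L → P.SmoothLoss L →
        0 < G → (∀ Θ, ‖gradient P.obj Θ‖ ≤ G) →
        0 < P.noise σ →
        -- the samples are i.i.d. from the interaction distribution
        (∀ t, Measurable (ξ t)) →
        (∀ t, μ.map (ξ t) = P.D.toMeasure) →
        iIndepFun ξ μ →
        -- the output index is uniform on the second half and independent of the samples
        Measurable τ →
        μ.map τ = (outputLaw T).toMeasure →
        IndepFun τ (fun ω t => ξ t ω) μ →
        -- bounded conditional variance, given the past, at the iterates of the run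
        (∀ t ≤ T, ∀ᵐ ω ∂μ,
          P.CondVarianceLE σ (cfsgd P L (P.stepConst L σ Θ₀) T Θ₀ (fun s => ξ s ω) t)) →
        ∀ k : U ⊕ V,
          max (⨅ l, 1 / P.freq l)
              ((2 * Real.log G
                  - Real.log (P.Mf L σ Θ₀ *
                      (1 / (2 * L) + P.stepConst L σ Θ₀ / √(P.freq k)))) / P.freq k)
            ≤ (T : ℝ) →
          Integrable (fun ω =>
            ‖gradient P.obj
              (cfsgd P L (P.stepConst L σ Θ₀) T Θ₀ (fun s => ξ s ω) (τ ω)) k‖ ^ 2) μ ∧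
          ∫ ω, ‖gradient P.obj
              (cfsgd P L (P.stepConst L σ Θ₀) T Θ₀ (fun s => ξ s ω) (τ ω)) k‖ ^ 2 ∂μ
            ≤ C * (L * P.Mf L σ Θ₀ / T
                + √(P.freq k) * √(P.noise σ * L * (P.obj Θ₀ - P.optVal)) / √T
                + √(P.freq k) * P.noise σ / √T) := by
  classical
  -- `500` is the constant of `rate_le`, and exceeds `36 * 5` from the case `p_k T ≤ 5`
  refine ⟨500, by norm_num, ?_⟩
  intro U V _ _ _ _ _ _ d P L G σ Θ₀ T Ω _ μ _ ξ τ hp hb hL h _ _ hσ hξm hξmap hξind hτ hτT hτind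
    hv k hTk
  have hξ : IIDSamples P.D ξ μ := ⟨hξm, hξmap, hξind⟩
  set M := P.Mf L σ Θ₀ with hM
  set α := P.stepConst L σ Θ₀ with hα
  have hMeq : M = P.obj Θ₀ - P.optVal + P.noise σ / L := P.Mf_eq L σ Θ₀
  have hΔ : 0 ≤ P.obj Θ₀ - P.optVal := sub_nonneg.2 (ciInf_le hb _)
  have hMpos : 0 < M := by
    rw [hMeq]
    have : 0 < P.noise σ / L := div_pos hσ hL
    linarith
  have hαpos : 0 < α := Real.sqrt_pos.2 (by positivity)
  have hαM : L * α ^ 2 * P.noise σ = M := by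
    rw [hα, Problem.stepConst, Real.sq_sqrt (by positivity), ← hM]
    field_simp
  have hpk := hp k
  -- `T ≥ min 1 / p_l ≥ 1`
  have hT : 0 < T := by
    have : Nonempty (U ⊕ V) := ⟨k⟩
    have h1 : (1 : ℝ) ≤ ⨅ l, 1 / P.freq l :=
      le_ciInf fun l => (one_le_div (hp l)).2 (P.freq_le_one l)
    have h2 : (1 : ℝ) ≤ T := h1.trans ((le_max_left _ _).trans hTk)
    exact_mod_cast zero_lt_one.trans_le h2
  have hT' : (0 : ℝ) < T := by exact_mod_cast hT
  obtain ⟨hint, heq⟩ := integral_output_eq hξ hτ hτT hτind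
    (dependsOn_sq_norm_gradient (P := P) (L := L) (α := α) (T := T) (Θ₀ := Θ₀) k)
  refine ⟨hint, ?_⟩
  rw [heq]
  set I := Finset.Icc ((T + 1) / 2) T with hI
  have hcard : (T : ℝ) / 2 ≤ I.card := by
    -- `⌈T / 2⌉, …, T` are `⌊T / 2⌋ + 1` integers
    rw [hI, Nat.card_Icc, div_le_iff₀ (by norm_num)]
    have : T ≤ (T + 1 - (T + 1) / 2) * 2 := by omega
    exact_mod_cast this
  have hcard0 : (0 : ℝ) < I.card := lt_of_lt_of_le (by positivity) hcard
  rcases le_total 5 (P.freq k * T) with hlarge | hsmall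
  · refine le_trans ?_ (rate_le hL hσ hΔ hpk hT' hαpos hMeq hαM)
    exact mul_le_mul (inv_anti₀ (by positivity) hcard)
      (sum_integral_sq_norm_gradient_le hξ h hL hαpos hαM hb hp hT k hv hlarge)
      (Finset.sum_nonneg fun t _ => integral_nonneg fun ω => sq_nonneg _) (by positivity)
  · have hsum : ∑ t ∈ I, ∫ ω, ‖gradient P.obj (cfsgd P L α T Θ₀ (fun s => ξ s ω) t) k‖ ^ 2 ∂μ
        ≤ I.card * (36 * (L * P.freq k * M)) := by
      rw [← nsmul_eq_mul]
      exact Finset.sum_le_card_nsmul _ _ _ fun t ht =>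
        integral_sq_norm_gradient_le hξ h hL hαpos.le hαM hb hp hT k hv
          ((Finset.mem_Icc.1 ht).2.trans (Nat.le_succ T))
    have h1 : L * P.freq k * M ≤ 5 * (L * M / T) := by
      calc L * P.freq k * M = P.freq k * T * (L * M / T) := by field_simp
        _ ≤ _ := mul_le_mul_of_nonneg_right hsmall (by positivity)
    have h2 : 0 ≤ L * M / T := by positivity
    have h3 : 0 ≤ √(P.freq k) * √(P.noise σ * L * (P.obj Θ₀ - P.optVal)) / √T := by positivity
    have h4 : 0 ≤ √(P.freq k) * P.noise σ / √T := by positivity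
    rw [inv_mul_le_iff₀ hcard0]
    exact hsum.trans (mul_le_mul_of_nonneg_left (by linarith) hcard0.le)
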